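/- For $S\subseteq\mathbb{R}$ let $\#\mathrm{P}_S$ be the class of functions $f:\{0,1\}^*\to\mathbb{R}$ of the form $$f(x)=\sum_{u\in\{0,1\}^{p(|x|)}} w(x,u),$$ where $p$ is a polynomial and $w:\{0,1\}^*\times\{0,1\}^*\to S$ is approximable: there is a function $v:\{0,1\}^*\times\{0,1\}^*\times\mathbb{N}\to\mathbb{Z}$, computable in time polynomial in $|x|$, $|u|$ and $b$, with $|w(x,u)-v(x,u,b)/2^b|\le 2^{-b}$ for all $x,u,b$. Let $\mathrm{PP}_S$ be the class of the languages $\{x : f(x)\ge t\}$ with $f\in\#\mathrm{P}_S$ and $t\in\mathbb{Q}$. Let $\mathrm{PP}$ be the class of languages $L$ for which there are a polynomial $p$ and a polynomial-time predicate $T$ such that the fraction of the strings $u$ of length $p(|x|)$ with $T(x,u)=1$ is greater than $1/2$ if $x\in L$, and at most $1/2$ if $x\notin L$. Let $\langle M,y\rangle$ be the bitstring that consists of a self-delimiting code of the Turing machine $M$ followed by the input $y$, and let $H=\{\langle M,y\rangle : M \text{ halts on input } y\}$ be the halting problem. Define $h(x)=2^{-t}$ if $x=\langle M,y\rangle$ and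 $M$ halts on $y$ after exactly $t$ steps, and $h(x)=0$ if there are no such $M,y,t$. Let $w(x,u)=h(x)$ if $u$ consists of zeros only, and $w(x,u)=0$ otherwise. **Theorem.** 1. The weight function $w$ has rational values and is approximable, and $\sum_{u\in\{0,1\}^{p(|x|)}}w(x,u)=h(x)$ for every polynomial $p$ and every $x$. In particular $h\in\#\mathrm{P}_{\mathbb{Q}}$. 2. The function $h$ is not computable (there is no algorithm that on input $x$ outputs the rational number $h(x)$ as a fraction), and $h(\langle M,y\rangle)>0$ if and only if $M$ halts on $y$. So $\#\mathrm{P}_{\mathbb{Q}}$ contains uncomputable functions. 3. A problem in $\mathrm{PP}_{\mathbb{Q}}$ decides the halting problem: there is $L\in\mathrm{PP}_{\mathbb{Q}}$ such that for all $x$, $x\in H$ if and only if $x\notin L$; and $H$ is undecidable. **Corollary.** $\mathrm{PP}\subsetneq\mathrm{PP}_{\mathbb{Q}}$. -/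

import Mathlib

namespace WeightedCounting

/-! ### Polynomial-time computation on bitstrings -/

/-- Binary encoding of integers: a sign bit followed by the binary digits of the absolute value. -/
def encodingInt : Computability.Encoding ℤ Bool where
  encode z := decide (z < 0) :: Computability.encodeNat z.natAbs
  decode
    | [] => none
    | s :: l => some (if s then -(Computability.decodeNat l : ℤ) else Computability.decodeNat l)
  decode_encode z := by
    by_cases h : z < 0
    · simp [h, abs_of_neg h]
    · simp [h, abs_of_nonneg (not_lt.mp h)]

/-- Pairs of bitstrings. -/
def encodingPair : Computability.Encoding (List Bool × List Bool) (Bool ⊕ Bool) :=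
  Computability.encodingProd (Computability.encodingList Bool) (Computability.encodingList Bool)

/-- Triples `(x, u, b)`, where the number `b` is written in unary, so that a running time that is
polynomial in the length of the encoding is polynomial in `|x|`, `|u|` and `b`. -/
def encodingTriple :
    Computability.Encoding ((List Bool × List Bool) × ℕ) ((Bool ⊕ Bool) ⊕ Bool) :=
  Computability.encodingProd encodingPair Computability.unaryEncodingNat

/-- A polynomial-time predicate on pairs of bitstrings. -/
def PolyTimePredicate (T : List Bool → List Bool → Bool) : Prop :=
  Nonempty (Turing.TM2ComputableInPolyTime encodingPair.encode
    Computability.encodingBoolBool.encode (fun z : List Bool × List Bool => T z.1 z.2))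

/-- An integer-valued function `v x u b` that is computable in time polynomial in
`|x|`, `|u|` and `b`. -/
def PolyTimeApproximator (v : List Bool → List Bool → ℕ → ℤ) : Prop :=
  Nonempty (Turing.TM2ComputableInPolyTime encodingTriple.encode encodingInt.encode
    (fun z : (List Bool × List Bool) × ℕ => v z.1.1 z.1.2 z.2))

/-! ### The classes `PP`, `#P_S` and `PP_S` -/

/-- The class `PP`. -/
def PP : Set (Set (List Bool)) :=
  {L | ∃ (p : Polynomial ℕ) (T : List Bool → List Bool → Bool), PolyTimePredicate T ∧
    ∀ x : List Bool,
      (x ∈ L → (1 / 2 : ℚ) <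
        (Finset.univ.filter fun u : Fin (p.eval x.length) → Bool =>
          T x (List.ofFn u) = true).card / 2 ^ p.eval x.length) ∧
      (x ∉ L →
        ((Finset.univ.filter fun u : Fin (p.eval x.length) → Bool =>
          T x (List.ofFn u) = true).card : ℚ) / 2 ^ p.eval x.length ≤ 1 / 2)}

/-- The weight function `w` can be approximated to `b` bits in time polynomial in
`|x|`, `|u|` and `b`. -/
def Approximable (w : List Bool → List Bool → ℝ) : Prop :=
  ∃ v : List Bool → List Bool → ℕ → ℤ, PolyTimeApproximator v ∧
    ∀ (x u : List Bool) (b : ℕ), |w x u - (v x u b : ℝ) / 2 ^ b| ≤ 1 / 2 ^ b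

/-- The sum of the weights `w x u` over all bitstrings `u` of length `p(|x|)`. -/
noncomputable def weightedSum (p : Polynomial ℕ) (w : List Bool → List Bool → ℝ)
    (x : List Bool) : ℝ :=
  ∑ u : Fin (p.eval x.length) → Bool, w x (List.ofFn u)

/-- The class `#P_S` of weighted counting problems with weights in `S`. -/
def SharpPOver (S : Set ℝ) : Set (List Bool → ℝ) :=
  {f | ∃ (p : Polynomial ℕ) (w : List Bool → List Bool → ℝ),
    Approximable w ∧ (∀ x u, w x u ∈ S) ∧ f = weightedSum p w}

/-- The class `PP_S` of the corresponding decision problems, with a rational threshold. -/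
def PPOver (S : Set ℝ) : Set (Set (List Bool)) :=
  {L | ∃ f ∈ SharpPOver S, ∃ t : ℚ, L = {x | (t : ℝ) ≤ f x}}

/-- The rational numbers, as a set of real numbers. -/
def rationals : Set ℝ := Set.range ((↑) : ℚ → ℝ)

/-- The (rational) values of `f` can be computed exactly, as fractions. -/
def ExactlyComputable (f : List Bool → ℝ) : Prop :=
  ∃ (n : List Bool → ℤ) (d : List Bool → ℕ), Computable n ∧ Computable d ∧
    ∀ x, d x ≠ 0 ∧ f x = (n x : ℝ) / (d x : ℝ)

/-! ### Turing machines as bitstrings and the halting problem -/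

/-- An entry of a transition table: in state `state`, reading `symbol`, perform the action `act`
(move the head or write a symbol) and go to state `next`. -/
structure Row where
  state : ℕ
  symbol : ℕ
  next : ℕ
  act : Turing.TM0.Stmt ℕ

/-- A Turing machine, given by its finite transition table. The blank symbol and the initial state
are both `0`. The first entry that matches is used; the machine halts when no entry matches. -/
abbrev Table := List Row

/-- The transition function of a table. -/
def Table.machine (M : Table) : Turing.TM0.Machine ℕ ℕ := fun q a =>
  (M.find? fun r => r.state == q && r.symbol == a).map fun r => (r.next, r.act)

/-- The initial configuration on the bitstring `y`: the bits `false`, `true` are written as the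
symbols `1`, `2`. -/
noncomputable def initial (y : List Bool) : Turing.TM0.Cfg ℕ ℕ :=
  Turing.TM0.init (y.map fun b => if b then 2 else 1)

/-- `M` halts on input `y` after exactly `t` steps. -/
def HaltsIn (M : Table) (y : List Bool) (t : ℕ) : Prop :=
  ∃ c : Turing.TM0.Cfg ℕ ℕ,
    (fun o : Option (Turing.TM0.Cfg ℕ ℕ) => o.bind (Turing.TM0.step M.machine))^[t]
      (some (initial y)) = some c ∧
    Turing.TM0.step M.machine c = none

/-- The self-delimiting code `1ⁿ0` of a natural number. -/
def natCode (n : ℕ) : List Bool := List.replicate n true ++ [false]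

/-- The code of an action. -/
def actCode : Turing.TM0.Stmt ℕ → List Bool
  | .move .left => [true, false]
  | .move .right => [true, true]
  | .write a => false :: natCode a

/-- The code of a table entry. -/
def rowCode (r : Row) : List Bool :=
  natCode r.state ++ natCode r.symbol ++ natCode r.next ++ actCode r.act

/-- The code of a Turing machine: every entry is preceded by a `1`, and a `0` ends the list. -/
def tableCode : Table → List Bool
  | [] => [false]
  | r :: M => true :: (rowCode r ++ tableCode M)

/-- The bitstring `⟨M, y⟩`. -/
def pairCode (M : Table) (y : List Bool) : List Bool := tableCode M ++ y

theorem natCode_append_inj {m n : ℕ} {k l : List Bool} (h : natCode m ++ k = natCode n ++ l) :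
    m = n ∧ k = l := by
  induction m generalizing n with
  | zero => cases n <;> simp_all [natCode, List.replicate_succ]
  | succ m ih =>
    cases n with
    | zero => simp [natCode, List.replicate_succ] at h
    | succ n =>
      have := @ih n (by simpa [natCode, List.replicate_succ] using h)
      simpa using this

theorem actCode_append_inj {a b : Turing.TM0.Stmt ℕ} {k l : List Bool}
    (h : actCode a ++ k = actCode b ++ l) : a = b ∧ k = l := by
  rcases a with (_ | _) | a <;> rcases b with (_ | _) | b <;> simp [actCode] at h ⊢
  · exact h
  · exact h
  · exact natCode_append_inj (by simpa using h)

theorem tableCode_append_inj {M N : Table} {k l : List Bool}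
    (h : tableCode M ++ k = tableCode N ++ l) : M = N ∧ k = l := by
  induction M generalizing N with
  | nil => cases N <;> simp_all [tableCode]
  | cons r M ih =>
    cases N with
    | nil => simp [tableCode] at h
    | cons s N =>
      simp only [tableCode, rowCode, List.cons_append, List.append_assoc, List.cons.injEq,
        true_and] at h
      obtain ⟨h1, h⟩ := natCode_append_inj h
      obtain ⟨h2, h⟩ := natCode_append_inj h
      obtain ⟨h3, h⟩ := natCode_append_inj h
      obtain ⟨h4, h⟩ := actCode_append_inj h
      obtain ⟨h5, h⟩ := ih h
      refine ⟨?_, h⟩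
      cases r; cases s
      simp_all

/-- A bitstring is the code of at most one pair of a machine and an input. -/
theorem pairCode_inj {M N : Table} {y z : List Bool} (h : pairCode M y = pairCode N z) :
    M = N ∧ y = z :=
  tableCode_append_inj h

/-- `x` is `⟨M, y⟩` for a machine `M` that halts on input `y` after exactly `t` steps. -/
def CodeHaltsIn (x : List Bool) (t : ℕ) : Prop :=
  ∃ (M : Table) (y : List Bool), x = pairCode M y ∧ HaltsIn M y t

/-- The halting problem. -/
def haltingProblem : Set (List Bool) := {x | ∃ t, CodeHaltsIn x t}

open Classical in
/-- `2^{-t}` if `x = ⟨M, y⟩` where `M` halts on `y` after `t` steps, and `0` otherwise. -/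
noncomputable def haltingValue (x : List Bool) : ℝ :=
  if h : ∃ t, CodeHaltsIn x t then 1 / 2 ^ Nat.find h else 0

/-- The weight function: `haltingValue x` on the path `u = 0…0`, and `0` on all other paths. -/
noncomputable def haltingWeight (x u : List Bool) : ℝ :=
  if ∀ b ∈ u, b = false then haltingValue x else 0

end WeightedCounting

open WeightedCounting

/-! An approximation to `b` bits need not tell a positive number below `2^{-b}` from `0`, and this
leaves room to hide an undecidable question in a rational weight. If `M` halts on `y` at a time `t ≤
b`, the numerator `2^{b-t}` is exact; otherwise `h < 2^{-b}` and the numerator `0` is good enough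
(`abs_haltingWeight_sub_le`). So a simulation of `b` steps suffices, although deciding `h > 0` is
the halting problem. The weight lives on the single path `0…0`, so its sum over all paths is `h`
itself. The same argument applies to `-h`, and `-h ≥ 0` holds exactly off the halting problem, whose
complement is therefore in `PP_ℚ` with threshold `0`.

To obtain polynomial time in the literal sense, an explicit stack machine parses the table, keeps
the simulated tape as two stacks of unary numbers and spends one of `b` units of fuel per simulated
step. The fuel `b - t` that is left at a halt becomes the zeros in the binary notation of `2^{b-t}`.
A simulated step enlarges the configuration by at most the length of the table code plus one, which
gives a cubic time bound (`reaches_result`, `polyTimeApproximator_haltingApprox`).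

Undecidability is a reduction from the halting problem for `Nat.Partrec.Code`. The compilation of
partial recursive functions to `TM0` ends in a machine with finite support, hence in a finite table
(`exists_table_haltsIn_iff`), and one universal table is enough. An exact fraction for `h` would
decide halting through its numerator.

For `PP ⊆ PP_ℚ`, accepting paths get the weight `1` and rejecting ones `-1`; the sum is an integer,
so it is positive if and only if it is at least `1`. The inclusion is strict because languages in
`PP` are decidable: polynomial-time machines have a primitive recursive simulation
(`primrec_of_polyTimePredicate`), and the accepting paths can be counted by brute force. -/

namespace WeightedCounting

open Turing

/-! ### Reaching a configuration within a number of steps -/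

/-- The configuration `b` is reached from `a` after at most `n` steps. -/
def ReachesWithin {α : Type*} (f : α → Option α) (n : ℕ) (a b : α) : Prop :=
  ∃ k ≤ n, (flip bind f)^[k] (some a) = some b

namespace ReachesWithin

variable {α : Type*} {f : α → Option α} {m n : ℕ} {a b c : α}

theorem refl (f : α → Option α) (n : ℕ) (a : α) : ReachesWithin f n a a := ⟨0, n.zero_le, rfl⟩

theorem mono (h : ReachesWithin f m a b) (hmn : m ≤ n) : ReachesWithin f n a b :=
  let ⟨k, hk, e⟩ := h
  ⟨k, hk.trans hmn, e⟩

theorem trans (h₁ : ReachesWithin f m a b) (h₂ : ReachesWithin f n b c) :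
    ReachesWithin f (m + n) a c := by
  obtain ⟨k, hk, e⟩ := h₁
  obtain ⟨l, hl, e'⟩ := h₂
  exact ⟨l + k, by omega, by rw [Function.iterate_add_apply, e, e']⟩

theorem head (h : f a = some b) (h₂ : ReachesWithin f n b c) : ReachesWithin f (n + 1) a c := by
  obtain ⟨k, hk, e⟩ := h₂
  exact ⟨k + 1, by omega, by rw [Function.iterate_succ_apply]; simpa [flip, h] using e⟩

theorem congr_right (h : ReachesWithin f n a b) (hbc : b = c) : ReachesWithin f n a c := hbc ▸ h

theorem single (h : f a = some b) : ReachesWithin f 1 a b := head h (refl f 0 b)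

/-- Reaching a final configuration, as it is used in the definition of the time complexity. -/
theorem nonempty_evalsToInTime (h : ReachesWithin f n a b) :
    Nonempty (StateTransition.EvalsToInTime f a (some b) n) :=
  let ⟨k, hk, e⟩ := h
  ⟨⟨⟨k, e⟩, hk⟩⟩

end ReachesWithin

/-! ### Programs that work on stacks of bits -/

/-- The symbols in the encoding of a triple. -/
abbrev TripleSymbol : Type := (Bool ⊕ Bool) ⊕ Bool

/-- The stacks of bits of the simulating machine. -/
inductive Reg
  | out | fuel | todo | done | aux
  /-- The state (`false`) and the scanned symbol (`true`) of the simulated machine. -/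
  | current (i : Bool)
  /-- The left (`false`) and the right (`true`) part of the simulated tape. -/
  | side (d : Bool)
  deriving DecidableEq, Fintype

/-- The alphabets of the stacks: the stack `none` holds the input. -/
def StackSymbol : Option Reg → Type
  | none => TripleSymbol
  | some _ => Bool

instance : Fintype (StackSymbol none) := inferInstanceAs (Fintype TripleSymbol)

/-- Statements of the simulating machine. -/
abbrev Instr (Λ : Type) : Type := TM2.Stmt StackSymbol Λ (Option TripleSymbol)

namespace Instr

variable {Λ : Type}

/-- Push a bit. -/
def pushBit (k : Reg) (b : Bool) (q : Instr Λ) : Instr Λ := .push (some k) (fun _ => b) q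

/-- Pop a bit, and branch on the result. -/
def popBit (k : Reg) (empty one zero : Instr Λ) : Instr Λ :=
  .pop (some k) (fun _ (o : Option Bool) => o.map Sum.inr) <|
    .branch (·.isNone) empty <|
      .branch (· == some (Sum.inr true)) (.load (fun _ => none) one) (.load (fun _ => none) zero)

/-- Pop the input, and keep the result in the internal state. -/
def popInput (q : Instr Λ) : Instr Λ := .pop none (fun _ (o : Option TripleSymbol) => o) q

/-- Go to a fixed label. -/
def jump (l : Λ) : Instr Λ := .goto fun _ => l

/-- Move the top of one stack to another one, and repeat this until the first one is empty. -/
def moveAll (src dst : Reg) (self next : Λ) : Instr Λ :=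
  popBit src (jump next) (pushBit dst true (jump self)) (pushBit dst false (jump self))

end Instr

open Instr

/-- The stacks of the machine: the input and the stacks of bits. -/
def stackMap (i : List TripleSymbol) (s : Reg → List Bool) : ∀ k, List (StackSymbol k)
  | none => i
  | some k => s k

@[simp] theorem update_stackMap_some (i : List TripleSymbol) (s : Reg → List Bool) (k : Reg)
    (l : List Bool) :
    Function.update (stackMap i s) (some k) l = stackMap i (Function.update s k l) := by
  funext k'
  rcases k' with _ | k'
  · rfl
  · by_cases h : k' = k
    · subst h
      exact (Function.update_self ..).trans (Function.update_self (β := fun _ => List Bool) ..).symm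
    · exact (Function.update_of_ne (by simpa using h) ..).trans
        (Function.update_of_ne (β := fun _ => List Bool) h ..).symm

@[simp] theorem update_stackMap_none (i j : List TripleSymbol) (s : Reg → List Bool) :
    Function.update (stackMap i s) none j = stackMap j s := by
  funext k'
  rcases k' with _ | k'
  · exact Function.update_self ..
  · exact Function.update_of_ne (by simp) ..

theorem replicate_append_cons {α : Type*} (n : ℕ) (a : α) (l : List α) :
    List.replicate n a ++ a :: l = a :: (List.replicate n a ++ l) := by
  simpa using congrArg (· ++ l)
    (List.replicate_succ'.symm.trans (List.replicate_succ (n := n) (a := a)))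

/-- Two stacks, with the indices `false` and `true`. -/
def pair (l₀ l₁ : List Bool) (i : Bool) : List Bool := if i then l₁ else l₀

@[simp] theorem pair_false (l₀ l₁ : List Bool) : pair l₀ l₁ false = l₀ := rfl
@[simp] theorem pair_true (l₀ l₁ : List Bool) : pair l₀ l₁ true = l₁ := rfl

@[simp] theorem update_pair_false (l₀ l₁ l : List Bool) :
    Function.update (pair l₀ l₁) false l = pair l l₁ := by
  funext i; cases i <;> rfl
@[simp] theorem update_pair_true (l₀ l₁ l : List Bool) :
    Function.update (pair l₀ l₁) true l = pair l₀ l := by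
  funext i; cases i <;> rfl

/-- The stacks of bits. -/
def store (o f t d x : List Bool) (g h : Bool → List Bool) : Reg → List Bool
  | .out => o
  | .fuel => f
  | .todo => t
  | .done => d
  | .aux => x
  | .current i => g i
  | .side i => h i

section

variable (o f t d x z : List Bool) (g h : Bool → List Bool) (i : Bool)

@[simp] theorem store_out : store o f t d x g h .out = o := rfl
@[simp] theorem store_fuel : store o f t d x g h .fuel = f := rfl
@[simp] theorem store_todo : store o f t d x g h .todo = t := rfl
@[simp] theorem store_done : store o f t d x g h .done = d := rfl
@[simp] theorem store_aux : store o f t d x g h .aux = x := rfl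
@[simp] theorem store_current : store o f t d x g h (.current i) = g i := rfl
@[simp] theorem store_side : store o f t d x g h (.side i) = h i := rfl

@[simp] theorem update_store_out :
    Function.update (store o f t d x g h) .out z = store z f t d x g h := by
  funext k; cases k <;> rfl
@[simp] theorem update_store_fuel :
    Function.update (store o f t d x g h) .fuel z = store o z t d x g h := by
  funext k; cases k <;> rfl
@[simp] theorem update_store_todo :
    Function.update (store o f t d x g h) .todo z = store o f z d x g h := by
  funext k; cases k <;> rfl
@[simp] theorem update_store_done :
    Function.update (store o f t d x g h) .done z = store o f t z x g h := by
  funext k; cases k <;> rfl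
@[simp] theorem update_store_aux :
    Function.update (store o f t d x g h) .aux z = store o f t d z g h := by
  funext k; cases k <;> rfl
@[simp] theorem update_store_current :
    Function.update (store o f t d x g h) (.current i) z =
      store o f t d x (Function.update g i z) h := by
  funext k; cases k <;> simp [Function.update, store]
@[simp] theorem update_store_side :
    Function.update (store o f t d x g h) (.side i) z =
      store o f t d x g (Function.update h i z) := by
  funext k; cases k <;> simp [Function.update, store]

end

/-- A configuration at a label. -/
def atLabel {Λ : Type} (lab : Λ) (i : List TripleSymbol) (s : Reg → List Bool) :
    TM2.Cfg StackSymbol Λ (Option TripleSymbol) := ⟨some lab, none, stackMap i s⟩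

section

variable {Λ : Type} (i : List TripleSymbol) (s : Reg → List Bool)

@[simp] theorem stepAux_pushBit (k : Reg) (b : Bool) (q : Instr Λ) :
    TM2.stepAux (pushBit k b q) none (stackMap i s) =
      TM2.stepAux q none (stackMap i (Function.update s k (b :: s k))) := by
  simp only [pushBit, TM2.stepAux]
  exact congrArg _ (update_stackMap_some i s k _)

-- Every branch resumes with the internal state `none`. Between labels all information is on the
-- stacks, and `atLabel` needs no state.
@[simp] theorem stepAux_popBit (k : Reg) (e t f : Instr Λ) :
    TM2.stepAux (popBit k e t f) none (stackMap i s) = match s k with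
      | [] => TM2.stepAux e none (stackMap i s)
      | true :: l => TM2.stepAux t none (stackMap i (Function.update s k l))
      | false :: l => TM2.stepAux f none (stackMap i (Function.update s k l)) := by
  change (bif ((s k).head?.map Sum.inr : Option TripleSymbol).isNone then
      TM2.stepAux e ((s k).head?.map Sum.inr) (Function.update (stackMap i s) (some k) (s k).tail)
    else bif ((s k).head?.map Sum.inr : Option TripleSymbol) == some (Sum.inr true) then
      TM2.stepAux t none (Function.update (stackMap i s) (some k) (s k).tail)
    else TM2.stepAux f none (Function.update (stackMap i s) (some k) (s k).tail)) = _
  rw [update_stackMap_some]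
  rcases hk : s k with _ | ⟨_ | _, l⟩
  · have : Function.update s k [] = s := by rw [← hk]; simp
    simp [this]
  · simp
    rfl
  · simp
    rfl

@[simp] theorem stepAux_popInput (q : Instr Λ) :
    TM2.stepAux (popInput q) none (stackMap i s) = TM2.stepAux q i.head? (stackMap i.tail s) :=
  congrArg (TM2.stepAux q _) (update_stackMap_none ..)

@[simp] theorem stepAux_jump (l : Λ) :
    TM2.stepAux (jump l : Instr Λ) none (stackMap i s) = atLabel l i s := rfl

theorem step_atLabel (M : Λ → Instr Λ) (l : Λ) :
    TM2.step M (atLabel l i s) = some (TM2.stepAux (M l) none (stackMap i s)) := rfl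

end

/-- One step per bit and one to notice that the source is empty. The word arrives reversed, so two
transfers restore it. -/
theorem reachesWithin_moveAll {Λ : Type} {M : Λ → Instr Λ} {src dst : Reg} {self next : Λ}
    (hM : M self = moveAll src dst self next) (hne : src ≠ dst) (i : List TripleSymbol)
    (s : Reg → List Bool) :
    ReachesWithin (TM2.step M) ((s src).length + 1) (atLabel self i s) (atLabel next i
      (Function.update (Function.update s src []) dst ((s src).reverse ++ s dst))) := by
  induction h : s src generalizing s with
  | nil =>
    refine .single ?_
    rw [step_atLabel, hM]
    have : Function.update s src [] = s := by rw [← h]; simp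
    simp [moveAll, h, this]
  | cons b l ih =>
    have := ih (Function.update (Function.update s src l) dst (b :: s dst)) (by simp [hne])
    have h1 : TM2.step M (atLabel self i s) =
        some (atLabel self i (Function.update (Function.update s src l) dst (b :: s dst))) := by
      rw [step_atLabel, hM]
      cases b <;> simp [moveAll, h, hne.symm]
    have h2 := ReachesWithin.head h1 this
    convert h2 using 2
    · rfl
    funext k
    by_cases h3 : k = src
    · subst h3; simp [hne]
    · by_cases h4 : k = dst
      · subst h4; simp
      · simp [h3, h4]

/-! ### A machine that simulates a table -/

/-- The parts of the code of a table entry. -/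
inductive CodePart
  | flag | state | symbol | next | act | dir | write
  deriving DecidableEq

instance : Fintype CodePart :=
  ⟨{.flag, .state, .symbol, .next, .act, .dir, .write}, fun k => by cases k <;> simp⟩

/-- The part of a table entry that follows a bit of the code. -/
def CodePart.after : CodePart → Bool → CodePart
  | flag, _ => state
  | state, b => if b then state else symbol
  | symbol, b => if b then symbol else next
  | next, b => if b then next else act
  | act, b => if b then dir else write
  | dir, _ => flag
  | write, b => if b then write else flag

/-- The labels of the simulating machine. -/
inductive SimLabel
  | split (bad : Bool) | restack | parse (p : CodePart) | turn | encode | load (d : Bool)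
  | rewind | flag | compare (i ok : Bool) | restore (i ok : Bool) | skip (p : CodePart)
  | check | erase (i : Bool) | read (i : Bool) | act | dir | store (d : Bool)
  | win | answer | lose | clear
  deriving Fintype

/-- Pop a stack, and remember in the internal state whether there was something to pop. -/
def Instr.drop {Λ : Type} (k : Reg) (q : Instr Λ) : Instr Λ :=
  .pop (some k) (fun v (o : Option Bool) => if o.isSome then some (Sum.inr true) else v) q

/-- The program of the simulating machine. If the simulated machine halts, the output is a power
of two with the sign bit `neg`. -/
def simProgram (neg : Bool) : SimLabel → Instr SimLabel
  -- The input is sorted: `x` goes to `done`, `u` is only tested for a `1`, which sets `bad`, and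
  -- each symbol of the unary `b` becomes a unit of fuel.
  | .split bad => popInput <|
    .branch (·.isNone) (jump (if bad then .lose else .restack)) <|
    .branch (· == some (.inl (.inl true)))
      (.load (fun _ => none) <| pushBit .done true <| jump (.split bad)) <|
    .branch (· == some (.inl (.inl false)))
      (.load (fun _ => none) <| pushBit .done false <| jump (.split bad)) <|
    .branch (· == some (.inl (.inr true))) (.load (fun _ => none) <| jump (.split true)) <|
    .branch (· == some (.inl (.inr false))) (.load (fun _ => none) <| jump (.split bad)) <|
      .load (fun _ => none) <| pushBit .fuel true <| jump (.split bad)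
  | .restack => moveAll .done .todo .restack (.parse .flag)
  | .parse p => popBit .todo (jump .lose)
      (pushBit .done true <| jump (.parse (p.after true)))
      (pushBit .done false <| jump (if p = .flag then .turn else .parse (p.after false)))
  | .turn => moveAll .todo .aux .turn .encode
  -- Codes are pushed from their last bit on: a `0` gives the code `10` of the symbol `1`, a `1`
  -- gives the code `110` of the symbol `2`.
  | .encode => popBit .aux (jump (.load true))
      (pushBit (.side true) false <| pushBit (.side true) true <| pushBit (.side true) true <|
        jump .encode)
      (pushBit (.side true) false <| pushBit (.side true) true <| jump .encode)
  -- An empty side stands for an infinite blank half tape: nothing is loaded, and the empty unary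
  -- number is the blank `0`.
  | .load d => popBit (.side d) (jump .rewind) (pushBit (.current true) true <| jump (.load d))
      (jump .rewind)
  | .rewind => moveAll .done .todo .rewind .flag
  | .flag => popBit .todo (jump .lose) (pushBit .done true <| jump (.compare false true))
      (pushBit .done false <| jump .win)
  -- Units that agree are parked on `aux`, from where `restore` puts them back; `ok` becomes `false`
  -- when one number turns out to be longer.
  | .compare i ok => popBit .todo (jump .lose)
      (pushBit .done true <| popBit (.current i) (jump (.compare i false))
        (pushBit .aux true <| jump (.compare i ok)) (jump .lose))
      (pushBit .done false <| popBit (.current i) (jump (.restore i ok))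
        (pushBit (.current i) true <| jump (.restore i false)) (jump .lose))
  | .restore i ok => moveAll .aux (.current i) (.restore i ok)
      (if i then if ok then .check else .skip .next else .compare true ok)
  | .skip p => popBit .todo (jump .lose)
      (pushBit .done true <| jump (if p.after true = .flag then .flag else .skip (p.after true)))
      (pushBit .done false <| jump (if p.after false = .flag then .flag else .skip (p.after false)))
  -- Fuel is demanded only after a matching entry has been found, so a halt after exactly `b` steps
  -- is still noticed.
  | .check => popBit .fuel (jump .lose) (jump (.erase false)) (jump .lose)
  | .erase i => popBit (.current i) (jump (.read i)) (jump (.erase i)) (jump (.erase i))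
  | .read i => popBit .todo (jump .lose)
      (pushBit .done true <| pushBit (.current i) true <| jump (.read i))
      (pushBit .done false <| jump (if i then .rewind else .act))
  | .act => popBit .todo (jump .lose) (pushBit .done true <| jump .dir)
      (pushBit .done false <| jump (.erase true))
  -- The scanned symbol goes to the side opposite to the move; its terminator has to be pushed
  -- before its units.
  | .dir => popBit .todo (jump .lose)
      (pushBit .done true <| pushBit (.side false) false <| jump (.store true))
      (pushBit .done false <| pushBit (.side true) false <| jump (.store false))
  | .store d => popBit (.current true) (jump (.load d)) (pushBit (.side !d) true <| jump (.store d))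
      (jump .lose)
  -- The output is built from its last bit: the leading digit `1`, a `0` per unit of fuel left, then
  -- the sign bit.
  | .win => pushBit .out true <| jump .answer
  | .answer => popBit .fuel (pushBit .out neg <| jump .clear)
      (pushBit .out false <| jump .answer) (pushBit .out false <| jump .answer)
  | .lose => pushBit .out false <| jump .clear
  -- A final configuration in the sense of `haltList` has only the output left. Each round pops
  -- every work stack once, and the machine halts after a round in which all of them were empty.
  | .clear => drop .fuel <| drop .todo <| drop .done <| drop .aux <| drop (.current false) <|
      drop (.current true) <| drop (.side false) <| drop (.side true) <|
      .branch (·.isNone) .halt (.load (fun _ => none) <| jump .clear)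

/-- The simulating machine. -/
def simMachine (neg : Bool) : FinTM2 where
  K := Option Reg
  k₀ := none
  k₁ := some .out
  Γ := StackSymbol
  Λ := SimLabel
  main := .split false
  σ := Option TripleSymbol
  initialState := none
  m := simProgram neg

/-! ### Effect and running time of the routines of the simulating machine -/

section Simulation

variable (neg : Bool)

/-- A step of the simulating machine. -/
abbrev simStep := TM2.step (simProgram neg)

variable {neg}

theorem ReachesWithin.step {l : SimLabel} {i : List TripleSymbol} {s : Reg → List Bool} {n : ℕ}
    {c : TM2.Cfg StackSymbol SimLabel (Option TripleSymbol)}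
    (h : ReachesWithin (simStep neg) n
      (TM2.stepAux (simProgram neg l) none (stackMap i s)) c) :
    ReachesWithin (simStep neg) (n + 1) (atLabel l i s) c :=
  .head rfl h

theorem ReachesWithin.step_of_le {l : SimLabel} {i : List TripleSymbol} {s : Reg → List Bool}
    {m n : ℕ} {c : TM2.Cfg StackSymbol SimLabel (Option TripleSymbol)} (hmn : n + 1 ≤ m)
    (h : ReachesWithin (simStep neg) n
      (TM2.stepAux (simProgram neg l) none (stackMap i s)) c) :
    ReachesWithin (simStep neg) m (atLabel l i s) c :=
  h.step.mono hmn

variable (o f t d x : List Bool) (g h : Bool → List Bool)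

theorem stepAux_split_cons (bad : Bool) (c : TripleSymbol) (i : List TripleSymbol) :
    TM2.stepAux (simProgram neg (.split bad)) none (stackMap (c :: i) (store o f t d x g h)) =
      match c with
      | .inl (.inl b) => atLabel (.split bad) i (store o f t (b :: d) x g h)
      | .inl (.inr b) => atLabel (.split (bad || b)) i (store o f t d x g h)
      | .inr _ => atLabel (.split bad) i (store o (true :: f) t d x g h) := by
  rcases c with (b | b) | b <;> cases b <;> simp [simProgram] <;> rfl

theorem unaryEncodeNat_eq_replicate (b : ℕ) :
    Computability.unaryEncodeNat b = List.replicate b true := by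
  induction b with
  | zero => rfl
  | succ b ih => simp [Computability.unaryEncodeNat, ih, List.replicate_succ]

theorem encodingTriple_encode (y u : List Bool) (b : ℕ) :
    encodingTriple.encode ((y, u), b) = y.map (fun b => Sum.inl (Sum.inl b)) ++
      (u.map (fun b => Sum.inl (Sum.inr b)) ++ List.replicate b (Sum.inr true)) := by
  simp [encodingTriple, encodingPair, Computability.encodingProd, Computability.encodingList,
      Computability.unaryEncodingNat, unaryEncodeNat_eq_replicate, Function.comp_def]

theorem reaches_split (bad : Bool) (y u : List Bool) (b : ℕ) :
    ReachesWithin (simStep neg) (y.length + u.length + b + 1)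
      (atLabel (.split bad) (encodingTriple.encode ((y, u), b)) (store o f t d x g h))
      (atLabel (if bad || u.any id then .lose else .restack) []
        (store o (List.replicate b true ++ f) t (y.reverse ++ d) x g h)) := by
  rw [encodingTriple_encode]
  induction y generalizing d with
  | cons c y ih =>
    refine .step_of_le (n := y.length + u.length + b + 1) (by simp +arith) ?_
    simp only [List.map_cons, List.cons_append]
    rw [stepAux_split_cons]
    simpa using ih (c :: d)
  | nil =>
    induction u generalizing bad with
    | cons c u ih =>
      refine .step_of_le (n := u.length + b + 1) (by simp +arith) ?_
      simp only [List.map_nil, List.nil_append, List.map_cons, List.cons_append] at ih ⊢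
      rw [stepAux_split_cons]
      simpa [Bool.or_assoc] using ih (bad || c)
    | nil =>
      induction b generalizing f with
      | zero =>
        refine .step_of_le (n := 0) (by simp) ?_
        simpa [simProgram] using .refl _ _ _
      | succ b ih =>
        refine .step_of_le (n := b + 1) (by simp) ?_
        simp only [List.map_nil, List.nil_append, List.replicate_succ] at ih ⊢
        rw [stepAux_split_cons]
        simpa [replicate_append_cons] using ih (true :: f)

theorem reaches_encode (y : List Bool) (l r : List Bool) :
    ReachesWithin (simStep neg) (y.length + 1)
      (atLabel .encode [] (store o f t d y g (pair l r)))
      (atLabel (.load true) [] (store o f t d [] g (pair l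
        ((y.reverse.map fun b => if b then 2 else 1).flatMap natCode ++ r)))) := by
  induction y generalizing r with
  | nil => exact .step (by simpa [simProgram] using .refl _ _ _)
  | cons b y ih =>
    refine .step ?_
    cases b
    · simpa [simProgram, natCode, List.replicate_succ] using ih (true :: false :: r)
    · simpa [simProgram, natCode, List.replicate_succ] using ih (true :: true :: false :: r)

/-- Here `w` counts the units already parked on `aux`. At the end `min n m` more are parked and `m -
n` remain in place, so that nothing of the stored number is lost. -/
theorem reaches_compare (i ok : Bool) (m n w : ℕ) (hg : g i = List.replicate m true) :
    ReachesWithin (simStep neg) (n + 1)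
      (atLabel (.compare i ok) []
        (store o f (natCode n ++ t) d (List.replicate w true) g h))
      (atLabel (.restore i (ok && n == m)) [] (store o f t ((natCode n).reverse ++ d)
        (List.replicate (w + min n m) true) (Function.update g i (List.replicate (m - n) true))
          h)) := by
  induction n generalizing d g m w ok with
  | zero =>
    refine .step ?_
    cases m with
    | zero =>
      have : Function.update g i [] = g := by simpa using hg.symm
      simpa [simProgram, natCode, hg, this] using .refl _ _ _
    | succ m => simpa [simProgram, natCode, hg, List.replicate_succ] using .refl _ _ _
  | succ n ih =>
    refine .step ?_
    cases m with
    | zero =>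
      simpa [simProgram, natCode, hg, List.replicate_succ] using ih (true :: d) g false 0 w hg
    | succ m =>
      have := ih (true :: d) (Function.update g i (List.replicate m true)) ok m (w + 1) (by simp)
      simpa [simProgram, natCode, hg, List.replicate_succ, Nat.succ_min_succ, add_assoc,
        add_comm 1] using this

theorem reaches_compare_restore (i ok : Bool) (m n : ℕ) (hg : g i = List.replicate m true) :
    ReachesWithin (simStep neg) (2 * n + 2)
      (atLabel (.compare i ok) [] (store o f (natCode n ++ t) d [] g h))
      (atLabel (if i then if ok && n == m then .check else .skip .next
          else .compare true (ok && n == m)) []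
        (store o f t ((natCode n).reverse ++ d) [] g h)) := by
  have h1 := reaches_compare (neg := neg) o f t d g h i ok m n 0 hg
  have h2 := reachesWithin_moveAll (M := simProgram neg) (self := .restore i (ok && n == m)) rfl
    (by simp) [] (store o f t ((natCode n).reverse ++ d) (List.replicate (0 + min n m) true)
      (Function.update g i (List.replicate (m - n) true)) h)
  have h3 : List.replicate (min n m) true ++ List.replicate (m - n) true = g i := by
    rw [hg, ← List.replicate_add]; congr 1; omega
  refine (h1.trans (by simpa [h3] using h2)).mono ?_
  omega

theorem reaches_skip_natCode (p p' : CodePart) (n : ℕ) (h₁ : p.after true = p)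
    (h₀ : p.after false = p') (hp : p ≠ .flag) :
    ReachesWithin (simStep neg) (n + 1)
      (atLabel (.skip p) [] (store o f (natCode n ++ t) d x g h))
      (atLabel (if p' = .flag then .flag else .skip p') []
        (store o f t ((natCode n).reverse ++ d) x g h)) := by
  induction n generalizing d with
  | zero => exact .step (by simpa [simProgram, natCode, h₀] using .refl _ _ _)
  | succ n ih =>
    refine .step ?_
    simpa [simProgram, natCode, h₁, hp, List.replicate_succ] using ih (true :: d)

theorem reaches_skip_actCode (a : TM0.Stmt ℕ) :
    ReachesWithin (simStep neg) (actCode a).length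
      (atLabel (.skip .act) [] (store o f (actCode a ++ t) d x g h))
      (atLabel .flag [] (store o f t ((actCode a).reverse ++ d) x g h)) := by
  rcases a with (_ | _) | a
  · refine .step_of_le (n := 1) (le_refl 2) ?_
    simp only [actCode, simProgram, stepAux_popBit, store_todo, List.cons_append, stepAux_pushBit,
      stepAux_jump, CodePart.after]
    refine .step_of_le (n := 0) (le_refl 1) ?_
    simpa [simProgram, CodePart.after] using .refl _ _ _
  · refine .step_of_le (n := 1) (le_refl 2) ?_
    simp only [actCode, simProgram, stepAux_popBit, store_todo, List.cons_append, stepAux_pushBit,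
      stepAux_jump, CodePart.after]
    refine .step_of_le (n := 0) (le_refl 1) ?_
    simpa [simProgram, CodePart.after] using .refl _ _ _
  · refine .step_of_le (n := a + 1) (by simp [actCode, natCode]) ?_
    simpa [simProgram, actCode, CodePart.after] using
      reaches_skip_natCode (neg := neg) o f t (false :: d) x g h .write .flag a rfl rfl (by simp)

theorem reaches_skip (n : ℕ) (a : TM0.Stmt ℕ) :
    ReachesWithin (simStep neg) (natCode n ++ actCode a).length
      (atLabel (.skip .next) [] (store o f (natCode n ++ (actCode a ++ t)) d x g h))
      (atLabel .flag [] (store o f t ((natCode n ++ actCode a).reverse ++ d) x g h)) := by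
  have h1 := reaches_skip_natCode (neg := neg) o f (actCode a ++ t) d x g h .next .act n rfl rfl
    (by simp)
  have h2 := reaches_skip_actCode (neg := neg) o f t ((natCode n).reverse ++ d) x g h a
  refine (h1.trans (by simpa using h2)).mono ?_
  simp [natCode]
  omega

theorem reaches_erase (i : Bool) :
    ReachesWithin (simStep neg) ((g i).length + 1)
      (atLabel (.erase i) [] (store o f t d x g h))
      (atLabel (.read i) [] (store o f t d x (Function.update g i []) h)) := by
  induction hl : g i generalizing g with
  | nil =>
    have : Function.update g i [] = g := by simpa using hl.symm
    exact .step (by simpa [simProgram, hl, this] using .refl _ _ _)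
  | cons b l ih =>
    refine .step ?_
    cases b <;> simpa [simProgram, hl] using ih (Function.update g i l) (by simp)

theorem reaches_read (i : Bool) (n : ℕ) (l : List Bool) (hg : g i = l) :
    ReachesWithin (simStep neg) (n + 1)
      (atLabel (.read i) [] (store o f (natCode n ++ t) d x g h))
      (atLabel (if i then .rewind else .act) [] (store o f t ((natCode n).reverse ++ d) x
        (Function.update g i (List.replicate n true ++ l)) h)) := by
  induction n generalizing d g l with
  | zero =>
    subst hg
    refine .step ?_
    simpa [simProgram, natCode] using .refl _ _ _
  | succ n ih =>
    refine .step ?_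
    have := ih (true :: d) (Function.update g i (true :: l)) (true :: l) (by simp)
    simpa [simProgram, natCode, hg, List.replicate_succ, replicate_append_cons] using this

theorem reaches_store (i : Bool) (n : ℕ) (hg : g true = List.replicate n true) :
    ReachesWithin (simStep neg) (n + 1)
      (atLabel (.store i) [] (store o f t d x g h))
      (atLabel (.load i) [] (store o f t d x (Function.update g true [])
        (Function.update h (!i) (List.replicate n true ++ h (!i))))) := by
  induction n generalizing g h with
  | zero =>
    have : Function.update g true [] = g := by simpa using hg.symm
    refine .step ?_
    simpa [simProgram, hg, this] using .refl _ _ _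
  | succ n ih =>
    refine .step ?_
    have := ih (Function.update g true (List.replicate n true))
      (Function.update h (!i) (true :: h (!i))) (by simp)
    simpa [simProgram, hg, List.replicate_succ, replicate_append_cons] using this

theorem reaches_load_aux (i : Bool) (n k : ℕ) (l : List Bool) (hg : g true = List.replicate k true)
    (hh : h i = natCode n ++ l) :
    ReachesWithin (simStep neg) (n + 1)
      (atLabel (.load i) [] (store o f t d x g h))
      (atLabel .rewind [] (store o f t d x (Function.update g true (List.replicate (n + k) true))
        (Function.update h i l))) := by
  induction n generalizing g h k with
  | zero =>
    have : Function.update g true (List.replicate k true) = g := by simpa using hg.symm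
    refine .step ?_
    simpa [simProgram, hh, natCode, this] using .refl _ _ _
  | succ n ih =>
    refine .step ?_
    have := ih (Function.update g true (true :: List.replicate k true))
      (Function.update h i (natCode n ++ l)) (k + 1) (by simp [List.replicate_succ]) (by simp)
    simpa [simProgram, hg, hh, natCode, List.replicate_succ, replicate_append_cons, add_assoc,
      add_comm 1] using this

/-- For the empty list, `headI` and `tail` yield a blank and the empty list again, which is how the
machine treats an empty stack. -/
theorem reaches_load (i : Bool) (L : List ℕ) (hg : g true = [])
    (hh : h i = L.flatMap natCode) :
    ReachesWithin (simStep neg) (L.headI + 1)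
      (atLabel (.load i) [] (store o f t d x g h))
      (atLabel .rewind [] (store o f t d x (Function.update g true (List.replicate L.headI true))
        (Function.update h i (L.tail.flatMap natCode)))) := by
  cases L with
  | nil =>
    have h1 : Function.update g true [] = g := by simpa using hg.symm
    have h2 : Function.update h i [] = h := by simpa using hh.symm
    refine .step ?_
    simpa [simProgram, hh, h1, h2] using .refl _ _ _
  | cons n L =>
    simpa using reaches_load_aux o f t d x g h i n 0 (L.flatMap natCode) hg (by simp [hh])

/-- Rewinding the code of the table. -/
theorem reaches_rewind :
    ReachesWithin (simStep neg) (d.length + 1) (atLabel .rewind [] (store o f t d x g h))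
      (atLabel .flag [] (store o f (d.reverse ++ t) [] x g h)) := by
  simpa using reachesWithin_moveAll (M := simProgram neg) (self := .rewind) rfl (by simp) []
    (store o f t d x g h)

theorem reaches_answer (n : ℕ) :
    ReachesWithin (simStep neg) (n + 1)
      (atLabel .answer [] (store o (List.replicate n true) t d x g h))
      (atLabel .clear [] (store (neg :: (List.replicate n false ++ o)) [] t d x g h)) := by
  induction n generalizing o with
  | zero =>
    refine .step ?_
    simpa [simProgram] using .refl _ _ _
  | succ n ih =>
    refine .step ?_
    simpa [simProgram, List.replicate_succ, replicate_append_cons] using ih (false :: o)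

@[simp] theorem stepAux_drop (k : Reg) (q : Instr SimLabel) (v : Option TripleSymbol)
    (i : List TripleSymbol) (s : Reg → List Bool) :
    TM2.stepAux (drop k q) v (stackMap i s) = TM2.stepAux q
      (if s k = [] then v else some (Sum.inr true))
      (stackMap i (Function.update s k (s k).tail)) := by
  change TM2.stepAux q (if (s k).head?.isSome then some (Sum.inr true) else v)
    (Function.update (stackMap i s) (some k) (s k).tail) = _
  rw [update_stackMap_some]
  cases s k <;> simp

/-- The final configuration. -/
def simHalt (o : List Bool) : TM2.Cfg StackSymbol SimLabel (Option TripleSymbol) :=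
  ⟨none, none, stackMap [] (store o [] [] [] [] (pair [] []) (pair [] []))⟩

/-- All work stacks shrink in parallel, so the time depends on the longest one only. -/
theorem reaches_clear (n : ℕ) (q a l r : List Bool) (hn : f.length ≤ n ∧ t.length ≤ n ∧
      d.length ≤ n ∧ x.length ≤ n ∧ q.length ≤ n ∧ a.length ≤ n ∧ l.length ≤ n ∧ r.length ≤ n) :
    ReachesWithin (simStep neg) (n + 1)
      (atLabel .clear [] (store o f t d x (pair q a) (pair l r))) (simHalt o) := by
  have key (f t d x q a l r : List Bool) : TM2.stepAux (simProgram neg .clear) none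
      (stackMap [] (store o f t d x (pair q a) (pair l r))) =
      if f = [] ∧ t = [] ∧ d = [] ∧ x = [] ∧ q = [] ∧ a = [] ∧ l = [] ∧ r = [] then simHalt o else
        atLabel .clear [] (store o f.tail t.tail d.tail x.tail (pair q.tail a.tail)
          (pair l.tail r.tail)) := by
    simp only [simProgram, stepAux_drop, store_fuel, store_todo, store_done, store_aux,
      store_current, store_side, update_store_fuel, update_store_todo, update_store_done,
      update_store_aux, update_store_current, update_store_side, update_pair_false,
      update_pair_true, pair_false, pair_true, TM2.stepAux]
    -- The stacks are examined in the order opposite to the popping: the last nonempty one already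
    -- settles the internal state.
    rcases r with _ | ⟨b, r⟩
    swap
    · simp
    rcases l with _ | ⟨b, l⟩
    swap
    · simp
    rcases a with _ | ⟨b, a⟩
    swap
    · simp
    rcases q with _ | ⟨b, q⟩
    swap
    · simp
    rcases x with _ | ⟨b, x⟩
    swap
    · simp
    rcases d with _ | ⟨b, d⟩
    swap
    · simp
    rcases t with _ | ⟨b, t⟩
    swap
    · simp
    rcases f with _ | ⟨b, f⟩
    swap
    · simp
    simp [simHalt]
  induction n generalizing f t d x q a l r with
  | zero =>
    refine .step_of_le (n := 0) (by simp) ?_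
    rw [key]
    simp only [Nat.le_zero, List.length_eq_zero_iff] at hn
    simpa [hn] using .refl _ _ _
  | succ n ih =>
    refine .step_of_le (n := n + 1) (by simp) ?_
    rw [key]
    split_ifs
    · exact .refl _ _ _
    · exact ih _ _ _ _ _ _ _ _ (by simp only [List.length_tail]; omega)

end Simulation
/-! ### Recognizing codes of tables -/

/-- Remove the code of a table from the front of a bitstring, starting within the code. -/
def parseCode : CodePart → List Bool → Option (List Bool)
  | _, [] => none
  | p, b :: z => if p = .flag ∧ b = false then some z else parseCode (p.after b) z

theorem parseCode_natCode {p p' : CodePart} (h₁ : p.after true = p) (h₀ : p.after false = p')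
    (hp : p ≠ .flag) (n : ℕ) (z : List Bool) :
    parseCode p (natCode n ++ z) = parseCode p' z := by
  induction n with
  | zero => simp [natCode, parseCode, h₀, hp]
  | succ n ih => simpa [natCode, List.replicate_succ, parseCode, h₁, hp] using ih

/-- The parser fails on the empty string, so a successful run must meet the terminator `0` of the
unary number. -/
theorem exists_natCode_of_parseCode {p p' : CodePart} (h₁ : p.after true = p)
    (h₀ : p.after false = p') (hp : p ≠ .flag) {z y : List Bool} (h : parseCode p z = some y) :
    ∃ n z', z = natCode n ++ z' ∧ parseCode p' z' = some y := by
  induction z with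
  | nil => simp [parseCode] at h
  | cons b z ih =>
    cases b with
    | false => exact ⟨0, z, rfl, by simpa [parseCode, hp, h₀] using h⟩
    | true =>
      obtain ⟨n, z', rfl, hz⟩ := ih (by simpa [parseCode, hp, h₁] using h)
      exact ⟨n + 1, z', rfl, hz⟩

theorem parseCode_actCode (a : TM0.Stmt ℕ) (z : List Bool) :
    parseCode .act (actCode a ++ z) = parseCode .flag z := by
  rcases a with (_ | _) | a
  · simp [actCode, parseCode, CodePart.after]
  · simp [actCode, parseCode, CodePart.after]
  · simpa [actCode, parseCode, CodePart.after] using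
      parseCode_natCode (p := .write) rfl rfl (by simp) a z

theorem exists_actCode_of_parseCode {z y : List Bool} (h : parseCode .act z = some y) :
    ∃ a z', z = actCode a ++ z' ∧ parseCode .flag z' = some y := by
  rcases z with _ | ⟨_ | _, z⟩
  · simp [parseCode] at h
  · obtain ⟨n, z', rfl, hz⟩ := exists_natCode_of_parseCode (p := .write) rfl rfl (by simp)
      (by simpa [parseCode, CodePart.after] using h)
    exact ⟨.write n, z', rfl, hz⟩
  · rcases z with _ | ⟨b, z⟩
    · simp [parseCode] at h
    · refine ⟨.move (if b then .right else .left), z, ?_, ?_⟩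
      · cases b <;> rfl
      · simpa [parseCode, CodePart.after] using h

theorem parseCode_tableCode (M : Table) (y : List Bool) :
    parseCode .flag (tableCode M ++ y) = some y := by
  induction M with
  | nil => simp [tableCode, parseCode]
  | cons r M ih =>
    simp only [tableCode, rowCode, List.cons_append, List.append_assoc, parseCode]
    simp only [reduceCtorEq, and_false, if_false, CodePart.after]
    rw [parseCode_natCode (p := .state) rfl rfl (by simp),
      parseCode_natCode rfl rfl (by simp [CodePart.after]),
      parseCode_natCode rfl rfl (by simp [CodePart.after])]
    exact (parseCode_actCode _ _).trans ih

theorem exists_tableCode_of_parseCode {z y : List Bool} (h : parseCode .flag z = some y) :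
    ∃ M, z = tableCode M ++ y := by
  -- The induction is on the length since an entry takes up a variable number of bits.
  induction hn : z.length using Nat.strong_induction_on generalizing z with
  | _ n ih =>
    rcases z with _ | ⟨_ | _, z⟩
    · simp [parseCode] at h
    · exact ⟨[], by simpa [parseCode, tableCode] using h⟩
    · obtain ⟨s, z₁, rfl, h₁⟩ := exists_natCode_of_parseCode (p := .state) rfl rfl (by simp)
        (by simpa [parseCode, CodePart.after] using h)
      obtain ⟨a, z₂, rfl, h₂⟩ := exists_natCode_of_parseCode (p := .symbol) rfl rfl (by simp) h₁
      obtain ⟨q, z₃, rfl, h₃⟩ := exists_natCode_of_parseCode (p := .next) rfl rfl (by simp) h₂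
      obtain ⟨m, z₄, rfl, h₄⟩ := exists_actCode_of_parseCode h₃
      obtain ⟨M, rfl⟩ := ih z₄.length (by simp at hn; omega) h₄ rfl
      exact ⟨⟨s, a, q, m⟩ :: M, by simp [tableCode, rowCode]⟩

section Simulation

variable {neg : Bool} (o f t d x : List Bool) (g h : Bool → List Bool)

theorem reaches_lose_of_parseCode {p : CodePart} (hp : parseCode p t = none) :
    ReachesWithin (simStep neg) (t.length + 1) (atLabel (.parse p) [] (store o f t d x g h))
      (atLabel .lose [] (store o f [] (t.reverse ++ d) x g h)) := by
  induction t generalizing p d with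
  | nil =>
    refine .step ?_
    simpa [simProgram] using .refl _ _ _
  | cons b t ih =>
    refine .step ?_
    by_cases h' : p = .flag ∧ b = false
    · simp [parseCode, h'] at hp
    · have := ih (b :: d) (p := p.after b) (by simpa [parseCode, h'] using hp)
      cases b <;> simp_all [simProgram]

/-- Moving bits from `todo` to `done` preserves the word formed by the reverse of `done` followed by
`todo`. This invariant determines `d'`. -/
theorem reaches_turn_of_parseCode {p : CodePart} {y : List Bool} (hp : parseCode p t = some y) :
    ∃ d', d'.reverse ++ y = d.reverse ++ t ∧
    ReachesWithin (simStep neg) (t.length + 1) (atLabel (.parse p) [] (store o f t d x g h))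
      (atLabel .turn [] (store o f y d' x g h)) := by
  induction t generalizing p d with
  | nil => simp [parseCode] at hp
  | cons b t ih =>
    by_cases h' : p = .flag ∧ b = false
    · obtain ⟨rfl, rfl⟩ := h'
      obtain rfl : t = y := by simpa [parseCode] using hp
      refine ⟨false :: d, by simp, .step ?_⟩
      simpa [simProgram] using .refl _ _ _
    · obtain ⟨d', hd, hr⟩ := ih (b :: d) (p := p.after b) (by simpa [parseCode, h'] using hp)
      refine ⟨d', by simpa using hd, .step ?_⟩
      cases b <;> simp_all [simProgram]

/-! ### Simulating a step -/

/-- The factor `2` pays for restoring a number after comparing it. -/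
theorem reaches_scan_skip (r : Row) (q a : ℕ) (hr : ¬(r.state == q && r.symbol == a) = true) :
    ReachesWithin (simStep neg) (2 * (rowCode r).length + 1)
      (atLabel .flag [] (store o f (true :: (rowCode r ++ t)) d []
        (pair (List.replicate q true) (List.replicate a true)) h))
      (atLabel .flag [] (store o f t ((rowCode r).reverse ++ true :: d) []
        (pair (List.replicate q true) (List.replicate a true)) h)) := by
  set g := pair (List.replicate q true) (List.replicate a true) with hg
  have h1 := reaches_compare_restore (neg := neg) o f (natCode r.symbol ++ (natCode r.next ++
    (actCode r.act ++ t))) (true :: d) g h false true q r.state rfl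
  have h2 := reaches_compare_restore (neg := neg) o f (natCode r.next ++
    (actCode r.act ++ t)) ((natCode r.state).reverse ++ true :: d) g h true (r.state == q) a
      r.symbol rfl
  have h3 := reaches_skip (neg := neg) o f t ((natCode r.symbol).reverse ++
    ((natCode r.state).reverse ++ true :: d)) [] g h r.next r.act
  simp only [Bool.false_eq_true, if_false, Bool.true_and] at h1
  simp only [if_true, hr] at h2
  refine .step_of_le ?_ (n := 2 * r.state + 2 + (2 * r.symbol + 2) +
    (natCode r.next ++ actCode r.act).length) ?_
  · simp [rowCode, natCode]; omega
  · simpa [simProgram, rowCode] using (h1.trans h2).trans h3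

theorem reaches_scan_check (r : Row) (q a : ℕ) (hr : (r.state == q && r.symbol == a) = true) :
    ReachesWithin (simStep neg) (2 * (rowCode r).length + 1)
      (atLabel .flag [] (store o f (true :: (rowCode r ++ t)) d []
        (pair (List.replicate q true) (List.replicate a true)) h))
      (atLabel .check [] (store o f (natCode r.next ++ (actCode r.act ++ t))
        ((natCode r.symbol).reverse ++ ((natCode r.state).reverse ++ true :: d)) []
        (pair (List.replicate q true) (List.replicate a true)) h)) := by
  set g := pair (List.replicate q true) (List.replicate a true) with hg
  have h1 := reaches_compare_restore (neg := neg) o f (natCode r.symbol ++ (natCode r.next ++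
    (actCode r.act ++ t))) (true :: d) g h false true q r.state rfl
  have h2 := reaches_compare_restore (neg := neg) o f (natCode r.next ++
    (actCode r.act ++ t)) ((natCode r.state).reverse ++ true :: d) g h true (r.state == q) a
      r.symbol rfl
  simp only [Bool.false_eq_true, if_false, Bool.true_and] at h1
  simp only [if_true, hr] at h2
  refine .step_of_le ?_ (n := 2 * r.state + 2 + (2 * r.symbol + 2)) ?_
  · simp [rowCode, natCode]; omega
  · simpa [simProgram, rowCode] using h1.trans h2
/-- Scanning the table for the entry that matches the state and the scanned symbol. -/
theorem reaches_scan_none (M : Table) (q a : ℕ)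
    (hM : M.find? (fun r => r.state == q && r.symbol == a) = none) :
    ReachesWithin (simStep neg) (2 * (tableCode M).length)
      (atLabel .flag [] (store o f (tableCode M) d []
        (pair (List.replicate q true) (List.replicate a true)) h))
      (atLabel .win [] (store o f [] ((tableCode M).reverse ++ d) []
        (pair (List.replicate q true) (List.replicate a true)) h)) := by
  induction M generalizing d with
  | nil =>
    refine .step_of_le (n := 0) (by simp [tableCode]) ?_
    simpa [simProgram, tableCode] using .refl _ _ _
  | cons r M ih =>
    rw [List.find?_cons] at hM
    split at hM
    · simp at hM
    · next hr =>
      have h1 := reaches_scan_skip (neg := neg) o f (tableCode M) d h r q a (by simp [hr])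
      refine ((h1.trans (ih _ hM)).mono ?_).congr_right ?_
      · simp +arith [tableCode]
      · simp [tableCode]

/-- All that has to be known about `t'` and `d'` is that rewinding recovers the complete code of the
table. -/
theorem reaches_scan_some (M : Table) (q a : ℕ) (r : Row)
    (hM : M.find? (fun r => r.state == q && r.symbol == a) = some r) :
    ∃ t' d', d'.reverse ++ (natCode r.next ++ (actCode r.act ++ t')) = d.reverse ++ tableCode M ∧
    ReachesWithin (simStep neg) (2 * (tableCode M).length)
      (atLabel .flag [] (store o f (tableCode M) d []
        (pair (List.replicate q true) (List.replicate a true)) h))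
      (atLabel .check [] (store o f (natCode r.next ++ (actCode r.act ++ t')) d' []
        (pair (List.replicate q true) (List.replicate a true)) h)) := by
  induction M generalizing d with
  | nil => simp at hM
  | cons r' M ih =>
    rw [List.find?_cons] at hM
    split at hM
    · next hr =>
      obtain rfl : r' = r := by simpa using hM
      refine ⟨_, _, ?_, (reaches_scan_check (neg := neg) o f (tableCode M) d h r' q a hr).mono ?_⟩
      · simp [tableCode, rowCode]
      · simp +arith [tableCode]
    · next hr =>
      have h1 := reaches_scan_skip (neg := neg) o f (tableCode M) d h r' q a (by simp [hr])
      obtain ⟨t', d', hd, h2⟩ := ih _ hM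
      refine ⟨t', d', by simpa [tableCode] using hd, (h1.trans h2).mono ?_⟩
      simp +arith [tableCode]

/-- The effect of an action on the scanned symbol and the two halves of the tape. -/
def actOn : TM0.Stmt ℕ → ℕ × List ℕ × List ℕ → ℕ × List ℕ × List ℕ
  | .write b, (_, L, R) => (b, L, R)
  | .move .left, (a, L, R) => (L.headI, L.tail, a :: R)
  | .move .right, (a, L, R) => (R.headI, a :: L, R.tail)

/-- The stacks that represent the two halves of the tape. -/
def tapeStacks (L R : List ℕ) : Bool → List Bool := pair (L.flatMap natCode) (R.flatMap natCode)

/-- The size of a configuration. -/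
def confSize (q : ℕ) (c : ℕ × List ℕ × List ℕ) : ℕ :=
  q + c.1 + (c.2.1.flatMap natCode).length + (c.2.2.flatMap natCode).length

theorem headI_le_length_flatMap (L : List ℕ) : L.headI ≤ (L.flatMap natCode).length := by
  cases L <;> simp +arith [natCode]

theorem length_flatMap_tail_add_headI_le (L : List ℕ) :
    L.headI + (L.tail.flatMap natCode).length ≤ (L.flatMap natCode).length := by
  cases L <;> simp +arith [natCode]

/-- The new state and a written symbol are spelled out in the table entry, and a move only regroups
the tape, up to one terminator. Hence configurations grow at most linearly with the number of steps.
-/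
theorem confSize_actOn_le (q n : ℕ) (s : TM0.Stmt ℕ) (c : ℕ × List ℕ × List ℕ) :
    confSize n (actOn s c) ≤ confSize q c + (natCode n ++ actCode s).length + 1 := by
  obtain ⟨a, L, R⟩ := c
  have := length_flatMap_tail_add_headI_le L
  have := length_flatMap_tail_add_headI_le R
  rcases s with (_ | _) | b <;> simp [confSize, actOn, natCode, actCode] at * <;> omega

theorem reaches_perform (n : ℕ) (s : TM0.Stmt ℕ) (q a : ℕ) (L R : List ℕ) :
    ReachesWithin (simStep neg) (2 * confSize q (a, L, R) + (natCode n ++ actCode s).length + 5)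
      (atLabel .check [] (store o (true :: f) (natCode n ++ (actCode s ++ t)) d []
        (pair (List.replicate q true) (List.replicate a true)) (tapeStacks L R)))
      (atLabel .rewind [] (store o f t ((actCode s).reverse ++ ((natCode n).reverse ++ d)) []
        (pair (List.replicate n true) (List.replicate (actOn s (a, L, R)).1 true))
        (tapeStacks (actOn s (a, L, R)).2.1 (actOn s (a, L, R)).2.2))) := by
  -- The summands are the times for erasing the old state, for reading the new one and for the
  -- action.
  refine .step_of_le (n := (q + 1) + (n + 1) + (2 * confSize 0 (a, L, R) + (actCode s).length + 2))
    (by simp [natCode, confSize]; omega) ?_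
  have h1 := reaches_erase (neg := neg) o f (natCode n ++ (actCode s ++ t)) d []
    (pair (List.replicate q true) (List.replicate a true)) (tapeStacks L R) false
  have h2 := reaches_read (neg := neg) o f (actCode s ++ t) d []
    (pair [] (List.replicate a true)) (tapeStacks L R) false n [] rfl
  simp only [pair_false, update_pair_false, List.length_replicate] at h1
  simp only [Bool.false_eq_true, if_false, update_pair_false, List.append_nil] at h2
  simp only [simProgram, stepAux_popBit, store_fuel, stepAux_jump, update_store_fuel]
  refine (h1.trans h2).trans ?_
  generalize (natCode n).reverse ++ d = d
  rcases s with (_ | _) | b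
  · refine .step_of_le (n := a + 1 + (L.headI + 1) + 1) ?_ ?_
    · have := headI_le_length_flatMap L
      simp [confSize, actCode, -List.length_flatMap]; omega
    simp only [simProgram, actCode, stepAux_popBit, store_todo, stepAux_jump, update_store_todo,
      List.cons_append, stepAux_pushBit, store_done, update_store_done]
    refine .step ?_
    have h3 := reaches_store (neg := neg) o f t (false :: true :: d) [] (pair (List.replicate n true)
      (List.replicate a true)) (pair (L.flatMap natCode) (false :: R.flatMap natCode)) false a rfl
    have h4 := reaches_load (neg := neg) o f t (false :: true :: d) [] (pair (List.replicate n true)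
      []) (tapeStacks L (a :: R)) false L rfl rfl
    simp [tapeStacks] at h3 h4
    simpa [simProgram, actOn, tapeStacks, natCode] using h3.trans (by simpa [natCode] using h4)
  · refine .step_of_le (n := a + 1 + (R.headI + 1) + 1) ?_ ?_
    · have := headI_le_length_flatMap R
      simp [confSize, actCode, -List.length_flatMap]; omega
    simp only [simProgram, actCode, stepAux_popBit, store_todo, stepAux_jump, update_store_todo,
      List.cons_append, stepAux_pushBit, store_done, update_store_done]
    refine .step ?_
    have h3 := reaches_store (neg := neg) o f t (true :: true :: d) [] (pair (List.replicate n true)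
      (List.replicate a true)) (pair (false :: L.flatMap natCode) (R.flatMap natCode)) true a rfl
    have h4 := reaches_load (neg := neg) o f t (true :: true :: d) [] (pair (List.replicate n true)
      []) (tapeStacks (a :: L) R) true R rfl rfl
    simp [tapeStacks] at h3 h4
    simpa [simProgram, actOn, tapeStacks, natCode] using h3.trans (by simpa [natCode] using h4)
  · refine .step_of_le (n := a + 1 + (b + 1)) ?_ ?_
    · simp [confSize, actCode, natCode]; omega
    have h3 := reaches_erase (neg := neg) o f (natCode b ++ t) (false :: d) []
      (pair (List.replicate n true) (List.replicate a true)) (tapeStacks L R) true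
    have h4 := reaches_read (neg := neg) o f t (false :: d) []
      (pair (List.replicate n true) []) (tapeStacks L R) true b [] rfl
    simp only [pair_true, update_pair_true, List.length_replicate] at h3
    simp only [if_true, update_pair_true, List.append_nil] at h4
    simpa [simProgram, actOn, actCode] using h3.trans h4

end Simulation
/-- `M` halts after exactly `t` steps, from the configuration `c`. -/
def HaltsFrom (M : Table) (c : TM0.Cfg ℕ ℕ) (t : ℕ) : Prop :=
  ∃ c' : TM0.Cfg ℕ ℕ,
    (fun o : Option (TM0.Cfg ℕ ℕ) => o.bind (TM0.step M.machine))^[t] (some c) = some c' ∧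
    TM0.step M.machine c' = none

theorem iterate_bind_none {α : Type*} (f : α → Option α) (t : ℕ) :
    (fun o : Option α => o.bind f)^[t] none = none := by
  induction t with
  | zero => rfl
  | succ t ih => simpa using ih

theorem haltsFrom_of_step_eq_none {M : Table} {c : TM0.Cfg ℕ ℕ}
    (h : TM0.step M.machine c = none) (t : ℕ) : HaltsFrom M c t ↔ t = 0 := by
  cases t with
  | zero => simp [HaltsFrom, h]
  | succ t => simp [HaltsFrom, h, iterate_bind_none]

theorem haltsFrom_of_step_eq_some {M : Table} {c c' : TM0.Cfg ℕ ℕ}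
    (h : TM0.step M.machine c = some c') (t : ℕ) :
    HaltsFrom M c t ↔ ∃ t', t = t' + 1 ∧ HaltsFrom M c' t' := by
  cases t with
  | zero => simp [HaltsFrom, h]
  | succ t => simp [HaltsFrom, h]

theorem HaltsFrom.unique {M : Table} {c : TM0.Cfg ℕ ℕ} {t t' : ℕ} (h : HaltsFrom M c t)
    (h' : HaltsFrom M c t') : t = t' := by
  induction t generalizing c t' with
  | zero =>
    obtain ⟨c', hc, hs⟩ := h
    obtain rfl : c = c' := by simpa using hc
    exact ((haltsFrom_of_step_eq_none hs t').1 h').symm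
  | succ t ih =>
    rcases hs : TM0.step M.machine c with _ | c'
    · simp [haltsFrom_of_step_eq_none hs] at h
    · obtain ⟨_, e, h₁⟩ := (haltsFrom_of_step_eq_some hs _).1 h
      obtain ⟨_, rfl, h₂⟩ := (haltsFrom_of_step_eq_some hs _).1 h'
      cases e
      rw [ih h₁ h₂]

/-- The configuration of a simulated machine. -/
def confOf (q : ℕ) (c : ℕ × List ℕ × List ℕ) : TM0.Cfg ℕ ℕ :=
  ⟨q, ⟨c.1, ListBlank.mk c.2.1, ListBlank.mk c.2.2⟩⟩

/-- `ListBlank.mk` identifies lists up to trailing blanks, so `headI` and `tail` describe the half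
tapes even when the stored list is empty. -/
theorem step_confOf (M : Table) (q : ℕ) (c : ℕ × List ℕ × List ℕ) :
    TM0.step M.machine (confOf q c) =
      (M.find? fun r => r.state == q && r.symbol == c.1).map fun r =>
        confOf r.next (actOn r.act c) := by
  obtain ⟨a, L, R⟩ := c
  simp only [TM0.step, confOf, Table.machine, Option.map_map]
  congr 1
  funext r
  simp only [Function.comp]
  rcases r.act with (_ | _) | b <;> simp [actOn, Tape.move, Tape.write]

theorem initial_eq (y : List Bool) (l : List ℕ) (hl : l = y.map fun b => if b then 2 else 1) :
    initial y = confOf 0 (l.headI, [], l.tail) := by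
  subst hl
  simp [initial, confOf, TM0.init, Tape.mk₁, Tape.mk₂, Tape.mk', Turing.ListBlank.head_mk]

/-! ### Correctness and cubic running time of the whole simulation -/

section Simulation

variable {neg : Bool}

/-- The result of the simulating machine. -/
def IsResult (neg : Bool) (n : ℕ) (P : ℕ → Prop) (res : List Bool) : Prop :=
  (∀ t ≤ n, P t → res = neg :: (List.replicate (n - t) false ++ [true])) ∧
    ((∀ t ≤ n, ¬P t) → res = [false])

theorem reaches_simHalt_of_lose (n : ℕ) (f t d x q a l r : List Bool) (hn : f.length ≤ n ∧ t.length ≤ n ∧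
      d.length ≤ n ∧ x.length ≤ n ∧ q.length ≤ n ∧ a.length ≤ n ∧ l.length ≤ n ∧ r.length ≤ n) :
    ReachesWithin (simStep neg) (n + 2)
      (atLabel .lose [] (store [] f t d x (pair q a) (pair l r))) (simHalt [false]) := by
  refine .step ?_
  simpa [simProgram] using reaches_clear [false] f t d x n q a l r hn

theorem reaches_simHalt_of_win (b n : ℕ) (t d x q a l r : List Bool) (hn : t.length ≤ n ∧
      d.length ≤ n ∧ x.length ≤ n ∧ q.length ≤ n ∧ a.length ≤ n ∧ l.length ≤ n ∧ r.length ≤ n) :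
    ReachesWithin (simStep neg) (b + n + 3)
      (atLabel .win [] (store [] (List.replicate b true) t d x (pair q a) (pair l r)))
      (simHalt (neg :: (List.replicate b false ++ [true]))) := by
  refine .step_of_le (n := (b + 1) + (n + 1)) (by omega) ?_
  simpa [simProgram] using (reaches_answer [true] t d x (pair q a) (pair l r) b).trans
    (reaches_clear (neg := neg) (neg :: (List.replicate b false ++ [true])) [] t d x n q a l r
      (by simpa using hn))

/-- Induction on the fuel `n`, one simulated step per unit. `S` bounds the size of all
configurations still to come, because each step adds at most the length of the table code plus one;
a round takes time linear in that length and in `S`. -/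
theorem reaches_simHalt_of_flag (M : Table) (n : ℕ) (q : ℕ) (c : ℕ × List ℕ × List ℕ) (S : ℕ)
    (hS : confSize q c + n * ((tableCode M).length + 1) ≤ S) :
    ∃ res, IsResult neg n (HaltsFrom M (confOf q c)) res ∧
    ReachesWithin (simStep neg) ((n + 1) * (4 * (tableCode M).length + 2 * S + 10) + S)
      (atLabel .flag [] (store [] (List.replicate n true) (tableCode M) [] []
        (pair (List.replicate q true) (List.replicate c.1 true)) (tapeStacks c.2.1 c.2.2)))
      (simHalt res) := by
  have hflag (n q) (c : ℕ × List ℕ × List ℕ) (hS : confSize q c ≤ S)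
      (hM : M.find? (fun r => r.state == q && r.symbol == c.1) = none) :
      ∃ res, IsResult neg n (HaltsFrom M (confOf q c)) res ∧
      ReachesWithin (simStep neg) (3 * (tableCode M).length + n + S + 3)
        (atLabel .flag [] (store [] (List.replicate n true) (tableCode M) [] []
          (pair (List.replicate q true) (List.replicate c.1 true)) (tapeStacks c.2.1 c.2.2)))
        (simHalt res) := by
    have hs : TM0.step M.machine (confOf q c) = none := by rw [step_confOf, hM]; rfl
    refine ⟨neg :: (List.replicate n false ++ [true]), ⟨fun t _ ht => ?_, fun h => ?_⟩, ?_⟩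
    · rw [(haltsFrom_of_step_eq_none hs t).1 ht, Nat.sub_zero]
    · exact absurd ((haltsFrom_of_step_eq_none hs 0).2 rfl) (h 0 n.zero_le)
    · have h1 := reaches_scan_none (neg := neg) [] (List.replicate n true) []
        (tapeStacks c.2.1 c.2.2) M q c.1 hM
      refine (h1.trans (reaches_simHalt_of_win n ((tableCode M).length + S) _ _ _ _ _ _ _ ?_)).mono
        ?_
      · simp only [confSize] at hS
        refine ⟨?_, ?_, ?_, ?_, ?_, ?_, ?_⟩ <;>
          (try simp only [List.length_append, List.length_reverse, List.length_replicate,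
            List.length_nil]) <;> omega
      · omega
  induction n generalizing q c with
  | zero =>
    rcases hM : M.find? (fun r => r.state == q && r.symbol == c.1) with _ | r
    · obtain ⟨res, h1, h2⟩ := hflag 0 q c (by omega) hM
      exact ⟨res, h1, h2.mono (by omega)⟩
    -- An entry applies but no fuel is left: the machine does not halt at time `0`, so the answer
    -- `0` is correct.
    · have hs : TM0.step M.machine (confOf q c) = some (confOf r.next (actOn r.act c)) := by
        rw [step_confOf, hM]; rfl
      refine ⟨[false], ⟨fun t ht h => ?_, fun _ => rfl⟩, ?_⟩
      · obtain ⟨t', rfl, -⟩ := (haltsFrom_of_step_eq_some hs t).1 h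
        omega
      · obtain ⟨t', d', hd, h1⟩ := reaches_scan_some (neg := neg) [] [] [] (tapeStacks c.2.1 c.2.2)
          M q c.1 r hM
        have hd := congrArg List.length hd
        simp only [List.length_append, List.length_reverse, List.length_nil] at hd
        have h2 := reaches_simHalt_of_lose (neg := neg) ((tableCode M).length + S) []
          (natCode r.next ++ (actCode r.act ++ t')) d' [] (List.replicate q true)
          (List.replicate c.1 true) (c.2.1.flatMap natCode) (c.2.2.flatMap natCode) (by
            simp only [confSize] at hS
            refine ⟨?_, ?_, ?_, ?_, ?_, ?_, ?_, ?_⟩ <;>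
          (try simp only [List.length_append, List.length_replicate,
            List.length_nil]) <;> omega)
        refine (h1.trans (.step_of_le (n := (tableCode M).length + S + 2) (le_refl _) ?_)).mono
          (by omega)
        simpa [simProgram, tapeStacks] using h2
  | succ n ih =>
    rcases hM : M.find? (fun r => r.state == q && r.symbol == c.1) with _ | r
    · obtain ⟨res, h1, h2⟩ := hflag (n + 1) q c (by nlinarith) hM
      refine ⟨res, h1, h2.mono (by nlinarith)⟩
    · have hs : TM0.step M.machine (confOf q c) = some (confOf r.next (actOn r.act c)) := by
        rw [step_confOf, hM]; rfl
      obtain ⟨t', d', hd, h1⟩ := reaches_scan_some (neg := neg) [] (List.replicate (n + 1) true) []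
        (tapeStacks c.2.1 c.2.2) M q c.1 r hM
      have h2 := reaches_perform (neg := neg) [] (List.replicate n true) t' d' r.next r.act q c.1
        c.2.1 c.2.2
      have h3 := reaches_rewind (neg := neg) [] (List.replicate n true) t'
        ((actCode r.act).reverse ++ ((natCode r.next).reverse ++ d')) []
        (pair (List.replicate r.next true) (List.replicate (actOn r.act c).1 true))
        (tapeStacks (actOn r.act c).2.1 (actOn r.act c).2.2)
      have hd' := congrArg List.length hd
      simp only [List.length_append, List.length_reverse, List.length_nil] at hd'
      have hsize := confSize_actOn_le q r.next r.act c
      simp only [List.length_append] at hsize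
      obtain ⟨res, h4, h5⟩ := ih r.next (actOn r.act c) (by nlinarith)
      refine ⟨res, ⟨fun t ht h => ?_, fun h => ?_⟩, ?_⟩
      · obtain ⟨t', rfl, h'⟩ := (haltsFrom_of_step_eq_some hs t).1 h
        rw [h4.1 t' (by omega) h', Nat.add_sub_add_right]
      · exact h4.2 fun t ht ht' => h (t + 1) (by omega)
          ((haltsFrom_of_step_eq_some hs _).2 ⟨t, rfl, ht'⟩)
      · have e : (List.reverse ((actCode r.act).reverse ++ ((natCode r.next).reverse ++ d'))) ++ t' =
            tableCode M := by simpa using hd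
        rw [e] at h3
        refine ((h1.trans ((h2.trans h3).trans h5))).mono ?_
        simp only [List.length_append, List.length_reverse]
        have : confSize q c ≤ S := by nlinarith
        nlinarith

/-- The configuration in which the simulating machine starts on an input. -/
def simStart (i : List TripleSymbol) : TM2.Cfg StackSymbol SimLabel (Option TripleSymbol) :=
  atLabel (.split false) i (store [] [] [] [] [] (pair [] []) (pair [] []))

theorem reaches_simHalt_of_table (M : Table) (y u : List Bool) (b : ℕ) (hu : ∀ c ∈ u, c = false) :
    ∃ res, IsResult neg b (HaltsIn M y) res ∧
    ReachesWithin (simStep neg) (100 * ((pairCode M y).length + u.length + b + 1) ^ 3)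
      (simStart (encodingTriple.encode ((pairCode M y, u), b))) (simHalt res) := by
  set x := pairCode M y with hx
  have hxl : x.length = (tableCode M).length + y.length := by simp [hx, pairCode]
  set l : List ℕ := y.map fun b => if b then 2 else 1 with hl
  have hll : (l.flatMap natCode).length ≤ 3 * y.length := by
    rw [hl]
    clear * -
    induction y with
    | nil => simp
    | cons b y ih =>
      simp only [List.map_cons, List.flatMap_cons, List.length_append, List.length_cons]
      cases b <;> simp [natCode] at ih ⊢ <;> omega
  have hlh := length_flatMap_tail_add_headI_le l
  have h1 := reaches_split (neg := neg) [] [] [] [] [] (pair [] []) (pair [] []) false x u b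
  have h2 := reachesWithin_moveAll (M := simProgram neg) (self := .restack) rfl (by simp) []
    (store [] (List.replicate b true) [] x.reverse [] (pair [] []) (pair [] []))
  obtain ⟨d, hd, h3⟩ := reaches_turn_of_parseCode (neg := neg) [] (List.replicate b true) x [] []
    (pair [] []) (pair [] []) (parseCode_tableCode M y)
  obtain rfl : d = (tableCode M).reverse := by
    simpa [hx, pairCode, ← List.reverse_eq_iff] using hd
  have h4 := reachesWithin_moveAll (M := simProgram neg) (self := .turn) rfl (by simp) []
    (store [] (List.replicate b true) y (tableCode M).reverse [] (pair [] []) (pair [] []))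
  have h5 := reaches_encode (neg := neg) [] (List.replicate b true) [] (tableCode M).reverse
    (pair [] []) y.reverse [] []
  have h6 := reaches_load (neg := neg) [] (List.replicate b true) [] (tableCode M).reverse []
    (pair [] []) (pair [] (l.flatMap natCode)) true l rfl rfl
  have h7 := reaches_rewind (neg := neg) [] (List.replicate b true) [] (tableCode M).reverse []
    (pair [] (List.replicate l.headI true)) (pair [] (l.tail.flatMap natCode))
  -- An input bit takes at most three bits on the tape stack, and each of the at most `b` steps adds
  -- at most the length of the table code plus one.
  set S := 3 * y.length + b * ((tableCode M).length + 1) with hS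
  obtain ⟨res, h8, h9⟩ := reaches_simHalt_of_flag (neg := neg) M b 0 (l.headI, [], l.tail) S (by
    simp only [confSize, List.flatMap_nil, List.length_nil]; omega)
  rw [← initial_eq y l hl] at h8
  refine ⟨res, h8, ?_⟩
  have hu' : u.any id = false := by simpa using hu
  simp only [hu', Bool.false_or, Bool.false_eq_true, if_false, List.append_nil] at h1
  simp at h2 h4 h5
  simp only [update_pair_true] at h6
  simp only [List.reverse_reverse, List.append_nil] at h7
  refine ((h1.trans h2).trans (h3.trans (h4.trans (h5.trans (h6.trans (h7.trans h9)))))).mono ?_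
  -- In terms of `N` the size bound `S` is quadratic, and there are at most `N` rounds, each linear
  -- in `S`.
  obtain ⟨N, hN⟩ : ∃ N, N = x.length + u.length + b + 1 := ⟨_, rfl⟩
  rw [← hN]
  have hNb : b + 1 ≤ N := by omega
  have hNT : (tableCode M).length + 1 ≤ N := by omega
  have hNy : y.length ≤ N := by omega
  have hNS : S ≤ 3 * N + N * N :=
    hS ▸ Nat.add_le_add (by omega) (Nat.mul_le_mul (by omega) hNT)
  have hmul : (b + 1) * (4 * (tableCode M).length + 2 * S + 10) ≤
      N * (4 * N + 2 * (3 * N + N * N) + 10) := Nat.mul_le_mul hNb (by omega)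
  have hN1 : 1 ≤ N := by omega
  have hN2 : N ≤ N * N := Nat.le_mul_of_pos_left _ hN1
  have hN3 : N * N ≤ N * (N * N) := Nat.le_mul_of_pos_left _ hN1
  rw [show 100 * N ^ 3 = 100 * (N * (N * N)) by ring]
  have : N * (4 * N + 2 * (3 * N + N * N) + 10) = 10 * (N * N) + 2 * (N * (N * N)) + 10 * N := by
    ring
  simp only [List.length_reverse]
  omega

/-- The answer `0` has three causes: a `1` in `u`, an `x` that does not start with a table code, or
no halt within `b` steps. As codes are unique, the parsed pair is the only one that `CodeHaltsIn`
can refer to. -/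
theorem reaches_result (x u : List Bool) (b : ℕ) :
    ∃ res, IsResult neg b (fun t => (∀ c ∈ u, c = false) ∧ CodeHaltsIn x t) res ∧
    ReachesWithin (simStep neg) (100 * (x.length + u.length + b + 1) ^ 3)
      (simStart (encodingTriple.encode ((x, u), b))) (simHalt res) := by
  have h1 := reaches_split (neg := neg) [] [] [] [] [] (pair [] []) (pair [] []) false x u b
  have hpow : x.length + u.length + b + 1 ≤ (x.length + u.length + b + 1) ^ 3 :=
    Nat.le_self_pow (by simp) _
  by_cases hu : ∀ c ∈ u, c = false
  · rcases hp : parseCode .flag x with _ | y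
    · refine ⟨[false], ⟨fun t _ h => ?_, fun _ => rfl⟩, ?_⟩
      · obtain ⟨M, y, rfl, -⟩ := h.2
        simp [pairCode, parseCode_tableCode] at hp
      · have hu' : u.any id = false := by simpa using hu
        have h2 := reachesWithin_moveAll (M := simProgram neg) (self := .restack) rfl (by simp) []
          (store [] (List.replicate b true) [] x.reverse [] (pair [] []) (pair [] []))
        have h3 := reaches_lose_of_parseCode (neg := neg) [] (List.replicate b true) x [] []
          (pair [] []) (pair [] []) hp
        have h4 := reaches_simHalt_of_lose (neg := neg) (x.length + b) (List.replicate b true) []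
          (x.reverse ++ []) [] [] [] [] [] (by simp)
        simp only [hu', Bool.false_or, Bool.false_eq_true, if_false, List.append_nil] at h1
        simp at h2
        exact ((h1.trans h2).trans (h3.trans h4)).mono (by omega)
    · obtain ⟨M, rfl⟩ := exists_tableCode_of_parseCode hp
      obtain ⟨res, h1, h2⟩ := reaches_simHalt_of_table (neg := neg) M y u b hu
      have : ∀ t, CodeHaltsIn (tableCode M ++ y) t ↔ HaltsIn M y t := by
        refine fun t => ⟨?_, fun h => ⟨M, y, rfl, h⟩⟩
        rintro ⟨N, z, e, h⟩
        obtain ⟨rfl, rfl⟩ := pairCode_inj (M := M) (y := y) e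
        exact h
      have : (fun t => (∀ c ∈ u, c = false) ∧ CodeHaltsIn (tableCode M ++ y) t) = HaltsIn M y :=
        funext fun t => propext (by rw [this, and_iff_right hu])
      exact ⟨res, by rwa [this], h2⟩
  · have hu' : u.any id = true := by simpa using hu
    have h4 := reaches_simHalt_of_lose (neg := neg) (x.length + b) (List.replicate b true) []
      x.reverse [] [] [] [] [] (by simp)
    refine ⟨[false], ⟨fun t _ h => absurd h.1 hu, fun _ => rfl⟩, ?_⟩
    simp only [hu', Bool.false_or, if_true, List.append_nil] at h1
    exact (h1.trans h4).mono (by omega)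

/-- The least significant digit comes first, so a power of two is a block of zeros closed by a one,
which leftover fuel can produce directly. -/
theorem encodeNat_two_pow (k : ℕ) :
    Computability.encodeNat (2 ^ k) = List.replicate k false ++ [true] := by
  have key : ∀ k, ∃ p : PosNum, (p : ℕ) = 2 ^ k ∧
      Computability.encodePosNum p = List.replicate k false ++ [true] := by
    intro k
    induction k with
    | zero => exact ⟨.one, rfl, rfl⟩
    | succ k ih =>
      obtain ⟨p, hp, he⟩ := ih
      refine ⟨p.bit0, ?_, ?_⟩
      · rw [PosNum.cast_bit0, hp]; ring
      · simp [Computability.encodePosNum, he, List.replicate_succ]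
  obtain ⟨p, hp, he⟩ := key k
  have : ((2 ^ k : ℕ) : Num) = Num.pos p := by
    rw [← hp]
    exact Num.of_to_nat (Num.pos p)
  rw [Computability.encodeNat, this, Computability.encodeNum, he]

theorem encodingInt_two_pow (neg : Bool) (k : ℕ) :
    encodingInt.encode ((if neg then -1 else 1) * 2 ^ k) =
      neg :: (List.replicate k false ++ [true]) := by
  have h : (0 : ℤ) < 2 ^ k := by positivity
  rw [← encodeNat_two_pow]
  cases neg
  · simp [encodingInt, Int.natAbs_pow, h.le]
  · simp [encodingInt, Int.natAbs_pow, h]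

open Classical in
/-- The approximation of the halting weight (or of its negative) that the machine computes. -/
noncomputable def haltingApprox (neg : Bool) (x u : List Bool) (b : ℕ) : ℤ :=
  if h : ∃ t ≤ b, (∀ c ∈ u, c = false) ∧ CodeHaltsIn x t then
    (if neg then -1 else 1) * 2 ^ (b - h.choose) else 0

theorem polyTimeApproximator_haltingApprox (neg : Bool) :
    PolyTimeApproximator (haltingApprox neg) := by
  refine ⟨⟨⟨simMachine neg, Equiv.refl _, Equiv.refl _⟩, 100 * (.X + 1) ^ 3, fun z => ?_⟩⟩
  obtain ⟨⟨x, u⟩, b⟩ := z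
  refine Classical.choice ?_
  obtain ⟨res, h1, h2⟩ := reaches_result (neg := neg) x u b
  have hres : res = encodingInt.encode (haltingApprox neg x u b) := by
    unfold haltingApprox
    by_cases h : ∃ t ≤ b, (∀ c ∈ u, c = false) ∧ CodeHaltsIn x t
    · rw [dif_pos h, encodingInt_two_pow, h1.1 _ h.choose_spec.1 h.choose_spec.2]
    -- The number `0` has no binary digits; its encoding is the sign bit alone.
    · rw [dif_neg h, h1.2 fun t ht h' => h ⟨t, ht, h'⟩]
      rfl
  have hlen : (encodingTriple.encode ((x, u), b)).length = x.length + u.length + b := by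
    simp [encodingTriple_encode, add_assoc]
  have hstart (l : List TripleSymbol) : initList (simMachine neg) l = simStart l := by
    unfold initList simStart atLabel
    congr 1
    funext k
    rcases k with _ | k
    · rfl
    · cases k with
      | current i => cases i <;> rfl
      | side i => cases i <;> rfl
      | _ => rfl
  have hhalt (l : List Bool) : haltList (simMachine neg) l = simHalt l := by
    unfold haltList simHalt
    congr 1
    funext k
    rcases k with _ | k
    · rfl
    · cases k with
      | current i => cases i <;> rfl
      | side i => cases i <;> rfl
      | _ => rfl
  have := h2.nonempty_evalsToInTime
  unfold TM2OutputsInTime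
  simp only [Equiv.invFun_as_coe, Equiv.refl_symm, Equiv.coe_refl, Option.map_some]
  rw [← hres]
  erw [List.map_id, List.map_id, hstart, hhalt]
  have htime : (100 * (Polynomial.X + 1) ^ 3 : Polynomial ℕ).eval
      (encodingTriple.encode ((x, u), b)).length = 100 * (x.length + u.length + b + 1) ^ 3 := by
    simp [hlen]
  rw [htime]
  exact this

end Simulation
/-! ### The halting weight -/

theorem CodeHaltsIn.unique {x : List Bool} {t t' : ℕ} (h : CodeHaltsIn x t)
    (h' : CodeHaltsIn x t') : t = t' := by
  obtain ⟨M, y, rfl, h⟩ := h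
  obtain ⟨N, z, e, h'⟩ := h'
  obtain ⟨rfl, rfl⟩ := pairCode_inj e
  exact HaltsFrom.unique h h'

theorem haltingValue_of_codeHaltsIn {x : List Bool} {t : ℕ} (h : CodeHaltsIn x t) :
    haltingValue x = 1 / 2 ^ t := by
  classical
  have h' : ∃ t, CodeHaltsIn x t := ⟨t, h⟩
  rw [haltingValue, dif_pos h', (Nat.find_spec h').unique h]

theorem haltingValue_of_forall_not {x : List Bool} (h : ∀ t, ¬CodeHaltsIn x t) :
    haltingValue x = 0 :=
  dif_neg (by simpa using h)

theorem haltingValue_pos_iff (x : List Bool) : 0 < haltingValue x ↔ x ∈ haltingProblem := by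
  by_cases h : ∃ t, CodeHaltsIn x t
  · obtain ⟨t, ht⟩ := h
    rw [haltingValue_of_codeHaltsIn ht]
    exact ⟨fun _ => ⟨t, ht⟩, fun _ => by positivity⟩
  · rw [haltingValue_of_forall_not (by simpa using h)]
    simpa [haltingProblem] using h

theorem haltingValue_nonneg (x : List Bool) : 0 ≤ haltingValue x := by
  by_cases h : ∃ t, CodeHaltsIn x t
  · obtain ⟨t, ht⟩ := h
    rw [haltingValue_of_codeHaltsIn ht]
    positivity
  · rw [haltingValue_of_forall_not (by simpa using h)]

theorem haltingValue_mem_rationals (x : List Bool) : haltingValue x ∈ rationals := by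
  by_cases h : ∃ t, CodeHaltsIn x t
  · obtain ⟨t, ht⟩ := h
    exact ⟨1 / 2 ^ t, by rw [haltingValue_of_codeHaltsIn ht]; simp⟩
  · exact ⟨0, by rw [haltingValue_of_forall_not (by simpa using h)]; simp⟩

theorem haltingWeight_mem_rationals (x u : List Bool) : haltingWeight x u ∈ rationals := by
  unfold haltingWeight
  split_ifs
  · exact haltingValue_mem_rationals x
  · exact ⟨0, by simp⟩

/-- If a halt is seen within `b` steps on the zero path, the approximation is exact. Otherwise the
weight is `0` or at most `2^{-b}`, and the approximation `0` is within the allowed error. -/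
theorem abs_haltingWeight_sub_le (neg : Bool) (x u : List Bool) (b : ℕ) :
    |(if neg then -1 else 1) * haltingWeight x u - (haltingApprox neg x u b : ℝ) / 2 ^ b| ≤
      1 / 2 ^ b := by
  have hb : (0 : ℝ) < 1 / 2 ^ b := by positivity
  have hs : |(if neg then -1 else 1 : ℝ)| = 1 := by cases neg <;> simp
  by_cases h : ∃ t ≤ b, (∀ c ∈ u, c = false) ∧ CodeHaltsIn x t
  · obtain ⟨ht, hu, hx⟩ := h.choose_spec
    have e : (2 : ℝ) ^ b = 2 ^ (b - h.choose) * 2 ^ h.choose := by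
      rw [← pow_add, Nat.sub_add_cancel ht]
    have : (if neg then -1 else 1) * haltingWeight x u -
        (haltingApprox neg x u b : ℝ) / 2 ^ b = 0 := by
      rw [haltingWeight, if_pos hu, haltingValue_of_codeHaltsIn hx, haltingApprox, dif_pos h, e]
      have h2 : (2 : ℝ) ^ (b - h.choose) ≠ 0 := by positivity
      push_cast
      cases neg <;> field_simp <;> simp
    rw [this, abs_zero]
    exact hb.le
  · rw [haltingApprox, dif_neg h]
    simp only [Int.cast_zero, zero_div, sub_zero, abs_mul, hs, one_mul]
    unfold haltingWeight
    split_ifs with hu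
    · by_cases h' : ∃ t, CodeHaltsIn x t
      · obtain ⟨t, ht⟩ := h'
        rw [haltingValue_of_codeHaltsIn ht, abs_of_pos (by positivity)]
        have : b ≤ t := by
          by_contra hbt
          exact h ⟨t, by omega, hu, ht⟩
        gcongr
        norm_num
      · rw [haltingValue_of_forall_not (by simpa using h'), abs_zero]
        exact hb.le
    · rw [abs_zero]
      exact hb.le

theorem approximable_haltingWeight : Approximable haltingWeight :=
  ⟨haltingApprox false, polyTimeApproximator_haltingApprox false, fun x u b => by
    simpa using abs_haltingWeight_sub_le false x u b⟩

theorem approximable_neg_haltingWeight : Approximable fun x u => -haltingWeight x u :=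
  ⟨haltingApprox true, polyTimeApproximator_haltingApprox true, fun x u b => by
    simpa using abs_haltingWeight_sub_le true x u b⟩

theorem weightedSum_haltingWeight (p : Polynomial ℕ) (x : List Bool) :
    weightedSum p haltingWeight x = haltingValue x := by
  unfold weightedSum
  rw [Finset.sum_eq_single fun _ => false]
  · simp [haltingWeight]
  · intro u _ hu
    refine if_neg fun h => hu (funext fun i => h _ ?_)
    exact (List.mem_ofFn' ..).2 ⟨i, rfl⟩
  · simp

theorem haltingValue_mem_sharpPOver : haltingValue ∈ SharpPOver rationals :=
  ⟨0, haltingWeight, approximable_haltingWeight, haltingWeight_mem_rationals,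
    (funext fun x => weightedSum_haltingWeight 0 x).symm⟩

/-- Halting is the strict inequality `h > 0`, while `PP_ℚ` offers `≥`. Negating the weight expresses
the complement as `-h ≥ 0`. -/
theorem compl_haltingProblem_mem_ppOver : haltingProblemᶜ ∈ PPOver rationals := by
  refine ⟨fun x => -haltingValue x, ⟨0, fun x u => -haltingWeight x u,
    approximable_neg_haltingWeight, fun x u => ?_, ?_⟩, 0, ?_⟩
  · obtain ⟨q, hq⟩ := haltingWeight_mem_rationals x u
    exact ⟨-q, by simp [hq]⟩
  · funext x
    rw [← weightedSum_haltingWeight 0 x]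
    simp [weightedSum]
  · ext x
    simp [← haltingValue_pos_iff]

/-! ### Undecidability of the halting problem -/

/-- Passes from counted steps to `StateTransition.eval`, the language of the compilation theorems.
-/
theorem exists_haltsIn_iff_eval_dom (M : Table) (y : List Bool) :
    (∃ t, HaltsIn M y t) ↔ (StateTransition.eval (TM0.step M.machine) (initial y)).Dom := by
  have key (c c' : TM0.Cfg ℕ ℕ) : StateTransition.Reaches (TM0.step M.machine) c c' ↔
      ∃ t, (fun o : Option (TM0.Cfg ℕ ℕ) => o.bind (TM0.step M.machine))^[t] (some c) =
        some c' := by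
    constructor
    · intro h
      induction h with
      | refl => exact ⟨0, rfl⟩
      | tail _ h ih =>
        obtain ⟨t, ht⟩ := ih
        refine ⟨t + 1, ?_⟩
        rw [Function.iterate_succ_apply', ht]
        exact h
    · rintro ⟨t, ht⟩
      induction t generalizing c' with
      | zero =>
        obtain rfl : c = c' := by simpa using ht
        exact .refl
      | succ t ih =>
        rw [Function.iterate_succ_apply'] at ht
        obtain ⟨d, hd, hs⟩ := Option.bind_eq_some_iff.1 ht
        exact (ih d hd).tail hs
  rw [Part.dom_iff_mem]
  simp only [StateTransition.mem_eval, key, HaltsIn]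
  tauto

/-- The number of a symbol of the alphabet: the blank is `0`, and `s₀`, `s₁` are `1`, `2`. -/
noncomputable def symbolNumber {Γ : Type} [Inhabited Γ] [Fintype Γ] (s₀ s₁ : Γ)
    (a : Γ) : ℕ :=
  open Classical in
  if a = default then 0 else if a = s₀ then 1 else if a = s₁ then 2 else 3 + Fintype.equivFin Γ a

theorem symbolNumber_injective {Γ : Type} [Inhabited Γ] [Fintype Γ] (s₀ s₁ : Γ) :
    Function.Injective (symbolNumber s₀ s₁) := by
  intro a b h
  unfold symbolNumber at h
  split_ifs at h <;> first | omega | simp_all [Fin.val_inj]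

/-! ### Tables for `TM0` machines with finitely many symbols and accessible states -/

section Table

variable {Γ Λ : Type} [Inhabited Γ] [Inhabited Λ] [Fintype Γ] (M : TM0.Machine Γ Λ) (S : Finset Λ)

open Classical in
/-- The number of a state. -/
noncomputable def stateNumber (q : Λ) : ℕ := 2 + S.toList.idxOf q

omit [Inhabited Λ] in
theorem stateNumber_inj {S : Finset Λ} {q q' : Λ} (hq : q ∈ S)
    (h : stateNumber S q = stateNumber S q') : q = q' := by
  classical
  unfold stateNumber at h
  exact (List.idxOf_inj (Finset.mem_toList.2 hq)).1 (by simpa using h)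

/-- The entries for the transitions of a machine with a finite alphabet and a finite set of
accessible states. -/
noncomputable def transitionRows (f : PointedMap Γ ℕ) : Table :=
  (S ×ˢ Finset.univ).toList.filterMap fun z : Λ × Γ => (M z.1 z.2).map fun r =>
    ⟨stateNumber S z.1, f z.2, stateNumber S r.1, TM0.Stmt.map f r.2⟩

/-- The table of a machine with a finite alphabet and a finite set of accessible states, that starts
with writing the symbol `c₀` to the left of the input. -/
noncomputable def tableOf (f : PointedMap Γ ℕ) (c₀ : Γ) : Table :=
  [⟨0, 0, 1, .move .left⟩, ⟨0, 1, 1, .move .left⟩, ⟨0, 2, 1, .move .left⟩,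
    ⟨1, 0, stateNumber S default, .write (f c₀)⟩] ++ transitionRows M S f

variable {M S} {f : PointedMap Γ ℕ} (c₀ : Γ)

/-- The start entries concern the states `0` and `1`, and `stateNumber` begins at `2`. Among the
other entries injectivity leaves only the one for `(q, a)`, so their order is irrelevant. -/
theorem tableOf_machine (hf : Function.Injective f) {q : Λ} (hq : q ∈ S) (a : Γ) :
    (tableOf M S f c₀).machine (stateNumber S q) (f a) =
      (M q a).map fun r => (stateNumber S r.1, TM0.Stmt.map f r.2) := by
  have h0 : 2 ≤ stateNumber S q := Nat.le_add_right ..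
  obtain ⟨m, hm⟩ : ∃ m, stateNumber S q = m + 2 := ⟨_, (Nat.sub_add_cancel h0).symm⟩
  set l := transitionRows M S f with hl
  have hfind : (tableOf M S f c₀).find? (fun r => r.state == stateNumber S q && r.symbol == f a) =
      l.find? (fun r => r.state == stateNumber S q && r.symbol == f a) := by
    rw [tableOf, List.find?_append]
    simp [hm, hl]
  have hmem (r : Row) (hr : r ∈ l) (h : (r.state == stateNumber S q && r.symbol == f a) = true) :
      ∃ r', M q a = some r' ∧
        r = ⟨stateNumber S q, f a, stateNumber S r'.1, TM0.Stmt.map f r'.2⟩ := by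
    simp only [hl, transitionRows, List.mem_filterMap, Finset.mem_toList, Finset.mem_product, Finset.mem_univ,
      and_true, Option.map_eq_some_iff] at hr
    obtain ⟨⟨q', a'⟩, hq', r', hr', rfl⟩ := hr
    simp only [Bool.and_eq_true, beq_iff_eq] at h
    obtain rfl := stateNumber_inj hq' h.1
    obtain rfl := hf h.2
    exact ⟨r', hr', rfl⟩
  rw [Table.machine, hfind]
  rcases h : l.find? (fun r => r.state == stateNumber S q && r.symbol == f a) with _ | r
  · rw [h]
    rcases hM : M q a with _ | r'
    · rfl
    · rw [List.find?_eq_none] at h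
      refine absurd ?_ (h ⟨stateNumber S q, f a, stateNumber S r'.1, TM0.Stmt.map f r'.2⟩ ?_)
      · simp
      · simp only [hl, transitionRows, List.mem_filterMap, Finset.mem_toList, Finset.mem_product, Finset.mem_univ,
          and_true, Option.map_eq_some_iff]
        exact ⟨(q, a), hq, r', hM, rfl⟩
  · obtain ⟨r', hr', rfl⟩ := hmem r (List.mem_of_find?_eq_some h)
      (List.find?_some (p := fun r : Row => r.state == stateNumber S q && r.symbol == f a) h)
    rw [h, hr']
    rfl

theorem respects_tableOf (hf : Function.Injective f) (hS : TM0.Supports M S) :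
    StateTransition.Respects (TM0.step M) (TM0.step (tableOf M S f c₀).machine)
      fun c d => c.q ∈ S ∧ d = ⟨stateNumber S c.q, c.Tape.map f⟩ := by
  rintro ⟨q, T⟩ _ ⟨hq, rfl⟩
  have hN := tableOf_machine (M := M) c₀ hf hq T.1
  have hstep : TM0.step (tableOf M S f c₀).machine ⟨stateNumber S q, T.map f⟩ =
      (M q T.1).map fun r => ⟨stateNumber S r.1, match TM0.Stmt.map f r.2 with
        | .move d => (T.map f).move d
        | .write a => (T.map f).write a⟩ := by
    rw [TM0.step]
    simp only [Tape.map_fst]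
    rw [hN, Option.map_map]
    refine congrArg (Option.map · _) (funext fun r => ?_)
    obtain ⟨q', s⟩ := r
    rcases s with d | b <;> rfl
  rcases hM : M q T.1 with _ | ⟨q', s⟩
  · simp only [TM0.step, hM, Option.map_none]
    exact hstep.trans (by rw [hM]; rfl)
  · simp only [TM0.step, hM, Option.map_some]
    refine ⟨_, ⟨hS.2 hM hq, rfl⟩, .single ?_⟩
    refine hstep.trans ?_
    rw [hM]
    rcases s with d | b
    · simp [TM0.Stmt.map, Tape.map_move]
    · simp [TM0.Stmt.map, Tape.map_write]

/-- The first scanned symbol is `0`, `1` or `2`, so the three entries for state `0` always move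
left. The cell found there is blank and receives `f c₀`. -/
theorem reaches_tableOf (y : List Bool) :
    StateTransition.Reaches (TM0.step (tableOf M S f c₀).machine) (initial y)
      ⟨stateNumber S default, Tape.mk₁ (f c₀ :: y.map fun b => if b then 2 else 1)⟩ := by
  set l : List ℕ := y.map fun b => if b then 2 else 1 with hl
  refine .head (b := ⟨1, (Tape.mk₁ l).move .left⟩) ?_ (.single ?_)
  · have h : (Tape.mk₁ l).1 = 0 ∨ (Tape.mk₁ l).1 = 1 ∨ (Tape.mk₁ l).1 = 2 := by
      rw [hl]
      rcases y with _ | ⟨_ | _, y⟩ <;> simp [Tape.mk₁, Tape.mk₂, Tape.mk']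
    rw [initial, ← hl]
    rcases h with h | h | h <;>
      simp [TM0.step, TM0.init, Table.machine, tableOf, h]
  · have h : Tape.mk₁ l = Tape.mk' (ListBlank.mk []) (ListBlank.mk l) := rfl
    have h' : Tape.mk₁ (f c₀ :: l) =
        Tape.mk' (ListBlank.mk []) (ListBlank.cons (f c₀) (ListBlank.mk l)) := rfl
    rw [h, h', Tape.move_left_mk']
    simp [TM0.step, Table.machine, tableOf]

theorem exists_haltsIn_tableOf_iff (hf : Function.Injective f) (hS : TM0.Supports M S) {s₀ s₁ : Γ}
    (h₀ : f s₀ = 1) (h₁ : f s₁ = 2) (y : List Bool) :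
    (∃ t, HaltsIn (tableOf M S f c₀) y t) ↔
      (TM0.eval M (c₀ :: y.map fun b => if b then s₁ else s₀)).Dom := by
  rw [exists_haltsIn_iff_eval_dom, StateTransition.reaches_eval (reaches_tableOf c₀ y), TM0.eval]
  refine StateTransition.tr_eval_dom (respects_tableOf c₀ hf hS) ⟨hS.1, ?_⟩
  simp only [TM0.init, Tape.map_mk₁, List.map_cons, List.map_map]
  congr 3
  refine List.map_congr_left fun b _ => ?_
  cases b <;> simp [h₀, h₁]

end Table

/-- The binary digits of a number, the most significant one first. -/
def digitsOf (n : ℕ) : List Bool := (Computability.encodeNat n).reverse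

theorem trNat_eq_map (n : ℕ) : PartrecToTM2.trNat n =
    (Computability.encodeNat n).map
      fun b => if b then PartrecToTM2.Γ'.bit1 else PartrecToTM2.Γ'.bit0 := by
  have key (p : PosNum) : PartrecToTM2.trPosNum p = (Computability.encodePosNum p).map
      fun b => if b then PartrecToTM2.Γ'.bit1 else PartrecToTM2.Γ'.bit0 := by
    induction p with
    | one => rfl
    | bit1 p ih => simp [PartrecToTM2.trPosNum, Computability.encodePosNum, ih]
    | bit0 p ih => simp [PartrecToTM2.trPosNum, Computability.encodePosNum, ih]
  rw [PartrecToTM2.trNat, Computability.encodeNat]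
  rcases (n : Num) with _ | p
  · rfl
  · exact key p

/-- The digits of `n` arise from the empty list by `n` binary increments, and an increment with
carry is a recursion on the list. -/
theorem primrec_encodeNat : Primrec Computability.encodeNat := by
  let inc : List Bool → List Bool := fun l => @List.rec Bool (fun _ => List Bool) [true]
    (fun b l ih => bif b then false :: ih else true :: l) l
  have hinc : Primrec inc := by
    have h : Primrec fun z : List Bool × Bool × List Bool × List Bool =>
        bif z.2.1 then false :: z.2.2.2 else true :: z.2.2.1 := by
      refine Primrec.cond ?_ ?_ ?_
      · exact Primrec.fst.comp Primrec.snd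
      · exact Primrec.list_cons.comp (.const _) (Primrec.snd.comp (Primrec.snd.comp Primrec.snd))
      · exact Primrec.list_cons.comp (.const _) (Primrec.fst.comp (Primrec.snd.comp Primrec.snd))
    exact Primrec.list_rec .id (.const _) h.to₂
  have hpos (p : PosNum) : Computability.encodePosNum p.succ =
      inc (Computability.encodePosNum p) := by
    induction p with
    | one => rfl
    | bit1 p ih => simpa [PosNum.succ, Computability.encodePosNum, inc] using ih
    | bit0 p ih => rfl
  have hsucc (n : ℕ) : Computability.encodeNat (n + 1) = inc (Computability.encodeNat n) := by
    rw [Computability.encodeNat, Computability.encodeNat, Nat.cast_succ]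
    rcases (n : Num) with _ | p
    · rfl
    · rw [Num.add_one]
      exact hpos p
  refine (Primrec.nat_iterate .id (.const []) (hinc.comp .snd).to₂).of_eq fun n => ?_
  induction n with
  | zero => rfl
  | succ n ih => rw [hsucc, ← ih]; exact Function.iterate_succ_apply' ..

theorem primrec_digitsOf : Primrec digitsOf := Primrec.list_reverse.comp primrec_encodeNat

/-- Every partial recursive function is the halting behaviour of a table. -/
theorem exists_table_haltsIn_iff {f : ℕ →. ℕ} (hf : Partrec f) :
    ∃ M : Table, ∀ n, (∃ t, HaltsIn M (digitsOf n) t) ↔ (f n).Dom := by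
  obtain ⟨c, hc⟩ := ToPartrec.Code.exists_code (Nat.Partrec'.part_iff₁.2 hf)
  -- The default label is the label at which the machine starts.
  let : Inhabited PartrecToTM2.Λ' := ⟨PartrecToTM2.trNormal c .halt⟩
  have hS := TM1to0.tr_supports _ (TM2to1.tr_supports _ (PartrecToTM2.tr_supports c .halt))
  let : Fintype (TM2to1.Γ' PartrecToTM2.K' fun _ => PartrecToTM2.Γ') := by
    have : Fintype PartrecToTM2.K' := ⟨{.main, .rev, .aux, .stack}, fun k => by cases k <;> decide⟩
    have : Fintype PartrecToTM2.Γ' := inferInstance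
    exact @TM2to1.Γ'.fintype _ _ _ _ fun _ => this
  let sym (a : PartrecToTM2.Γ') :
      TM2to1.Γ' PartrecToTM2.K' (fun _ => PartrecToTM2.Γ') :=
    (false, Function.update (fun _ => none) PartrecToTM2.K'.main (some a))
  -- `TM2to1` marks the bottom cell of the stacks by `true`. This cell carries the terminator `cons`
  -- of the list `[n]` and is written by the start entries of the table.
  let first : TM2to1.Γ' PartrecToTM2.K' (fun _ => PartrecToTM2.Γ') := (true, (sym .cons).2)
  have hsym : Function.Injective sym := fun a b h => by
    simpa [sym] using congrFun (congrArg Prod.snd h) PartrecToTM2.K'.main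
  have hdef (a) : sym a ≠ default := fun h => by
    simpa [sym] using congrFun (congrArg Prod.snd h) PartrecToTM2.K'.main
  let g : PointedMap (TM2to1.Γ' PartrecToTM2.K' fun _ => PartrecToTM2.Γ') ℕ :=
    ⟨symbolNumber (sym .bit0) (sym .bit1), by simp [symbolNumber]⟩
  have hg : Function.Injective g := symbolNumber_injective _ _
  have hg0 : g (sym .bit0) = 1 := by
    change symbolNumber _ _ _ = _
    simp [symbolNumber, hdef]
  have hg1 : g (sym .bit1) = 2 := by
    change symbolNumber _ _ _ = _
    simp [symbolNumber, hdef, hsym.eq_iff]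
  refine ⟨_, fun n => (exists_haltsIn_tableOf_iff first hg hS hg0 hg1 _).trans ?_⟩
  have hinit : (first :: (digitsOf n).map fun b => if b then sym .bit1 else sym .bit0)
      = TM2to1.trInit PartrecToTM2.K'.main (PartrecToTM2.trList [n]) := by
    -- The bottom of the stack comes first on the tape, which is why `digitsOf` starts with the most
    -- significant digit.
    have hrev : (PartrecToTM2.trList [n]).reverse = PartrecToTM2.Γ'.cons ::
        (digitsOf n).map fun b => if b then PartrecToTM2.Γ'.bit1 else PartrecToTM2.Γ'.bit0 := by
      simp [PartrecToTM2.trList, trNat_eq_map, digitsOf]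
    change _ = (true, ((PartrecToTM2.trList [n]).reverse.map sym).headI.2) ::
      ((PartrecToTM2.trList [n]).reverse.map sym).tail
    rw [hrev, List.map_cons, List.map_map]
    refine congrArg (first :: ·) (List.map_congr_left fun b _ => ?_)
    cases b <;> rfl
  rw [hinit, TM1to0.tr_eval]
  refine (TM2to1.tr_eval_dom _ _ _).trans ?_
  have hinit' : TM2.init PartrecToTM2.K'.main (PartrecToTM2.trList [n]) =
      PartrecToTM2.init c [n] := by
    simp only [TM2.init, PartrecToTM2.init]
    congr 1
    funext k
    cases k <;> rfl
  change (StateTransition.eval _ (TM2.init _ _)).Dom ↔ _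
  rw [hinit', PartrecToTM2.tr_eval, hc ⟨[n], rfl⟩]
  rfl

/-- A single table `M` for the universal function `c ↦ c.eval 0` reduces the halting of a code `c`
to the string made of `M` and the digits of `c`. Uniqueness of pair codes gives the converse
implication. -/
theorem not_computablePred_haltingProblem :
    ¬ComputablePred (fun x : List Bool => x ∈ haltingProblem) := by
  intro h
  have hf : Partrec fun n : ℕ => (Denumerable.ofNat Nat.Partrec.Code n).eval 0 :=
    Nat.Partrec.Code.eval_part.comp (Computable.ofNat _) (.const 0)
  obtain ⟨M, hM⟩ := exists_table_haltsIn_iff hf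
  refine ComputablePred.halting_problem 0 ?_
  refine ComputablePred.computable_of_manyOneReducible
    ⟨fun c => pairCode M (digitsOf (Encodable.encode c)), ?_, fun c => ?_⟩ h
  · exact (Primrec.list_append.comp (.const _) (primrec_digitsOf.comp .encode)).to_comp
  · have := hM (Encodable.encode c)
    rw [Denumerable.ofNat_encode] at this
    refine this.symm.trans ?_
    constructor
    · rintro ⟨t, ht⟩
      exact ⟨t, M, _, rfl, ht⟩
    · rintro ⟨t, M', y, h, ht⟩
      obtain ⟨rfl, rfl⟩ := pairCode_inj h
      exact ⟨t, ht⟩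

/-! ### Machines as subroutines -/

section Subroutine

variable {K E : Type} {Γ : K → Type} {Δ : E → Type} {Λ Λ₂ σ τ : Type}

/-- A statement of a subroutine, within a machine that has further stacks `Δ`, labels `Λ₂` and
states `τ`, and that goes to the label `next` when the subroutine halts. -/
def liftStmt (Δ : E → Type) (τ : Type) (next : Λ₂) :
    TM2.Stmt Γ Λ σ → TM2.Stmt (Sum.elim Γ Δ) (Λ ⊕ Λ₂) (σ × τ)
  | .push k f q => .push (.inl k) (fun v => f v.1) (liftStmt Δ τ next q)
  | .peek k f q => .peek (.inl k) (fun v o => (f v.1 o, v.2)) (liftStmt Δ τ next q)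
  | .pop k f q => .pop (.inl k) (fun v o => (f v.1 o, v.2)) (liftStmt Δ τ next q)
  | .load f q => .load (fun v => (f v.1, v.2)) (liftStmt Δ τ next q)
  | .branch p q₁ q₂ => .branch (fun v => p v.1) (liftStmt Δ τ next q₁) (liftStmt Δ τ next q₂)
  | .goto l => .goto fun v => .inl (l v.1)
  | .halt => .goto fun _ => .inr next

/-- The stacks of the subroutine, and the further stacks. -/
def joinStacks (S : ∀ k, List (Γ k)) (D : ∀ e, List (Δ e)) : ∀ k, List (Sum.elim Γ Δ k)
  | .inl k => S k
  | .inr e => D e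

/-- A configuration within the subroutine. -/
def liftCfg (next : Λ₂) (w : τ) (D : ∀ e, List (Δ e)) (c : TM2.Cfg Γ Λ σ) :
    TM2.Cfg (Sum.elim Γ Δ) (Λ ⊕ Λ₂) (σ × τ) :=
  ⟨some (c.l.elim (.inr next) .inl), (c.var, w), joinStacks c.stk D⟩

variable [DecidableEq K] [DecidableEq E]

theorem update_joinStacks_inl (S : ∀ k, List (Γ k)) (D : ∀ e, List (Δ e)) (k : K)
    (l : List (Γ k)) :
    Function.update (joinStacks S D) (.inl k) l = joinStacks (Function.update S k l) D := by
  funext k'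
  rcases k' with k' | e
  · by_cases h : k' = k
    · subst h
      exact (Function.update_self ..).trans (Function.update_self (f := S) ..).symm
    · exact (Function.update_of_ne (by simpa using h) ..).trans (Function.update_of_ne h ..).symm
  · exact Function.update_of_ne (by simp) ..

theorem update_joinStacks_inr (S : ∀ k, List (Γ k)) (D : ∀ e, List (Δ e)) (e : E)
    (l : List (Δ e)) :
    Function.update (joinStacks S D) (.inr e) l = joinStacks S (Function.update D e l) := by
  funext k'
  rcases k' with k' | e'
  · exact Function.update_of_ne (by simp) ..
  · by_cases h : e' = e
    · subst h
      exact (Function.update_self ..).trans (Function.update_self (f := D) ..).symm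
    · exact (Function.update_of_ne (by simpa using h) ..).trans (Function.update_of_ne h ..).symm

/-- The subroutine neither sees nor changes the extra stacks and the extra state, and its halting
becomes a jump to `next`; `liftCfg` likewise turns a missing label into `next`. -/
theorem stepAux_liftStmt (next : Λ₂) (w : τ) (D : ∀ e, List (Δ e)) (q : TM2.Stmt Γ Λ σ) (v : σ)
    (S : ∀ k, List (Γ k)) :
    TM2.stepAux (liftStmt Δ τ next q) (v, w) (joinStacks S D) =
      liftCfg next w D (TM2.stepAux q v S) := by
  induction q generalizing v S with
  | push k f q ih =>
    exact (congrArg (TM2.stepAux _ _) (update_joinStacks_inl S D k _)).trans (ih _ _)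
  | peek k f q ih => exact ih _ _
  | pop k f q ih =>
    exact (congrArg (TM2.stepAux _ _) (update_joinStacks_inl S D k _)).trans (ih _ _)
  | load f q ih => exact ih _ _
  | branch p q₁ q₂ ih₁ ih₂ =>
    simp only [liftStmt, TM2.stepAux, ih₁, ih₂]
    cases p v <;> rfl
  | goto l => rfl
  | halt => rfl

theorem reachesWithin_liftCfg {M : Λ → TM2.Stmt Γ Λ σ}
    {N : Λ ⊕ Λ₂ → TM2.Stmt (Sum.elim Γ Δ) (Λ ⊕ Λ₂) (σ × τ)} {next : Λ₂}
    (hN : ∀ l, N (.inl l) = liftStmt Δ τ next (M l)) (w : τ) (D : ∀ e, List (Δ e)) {n : ℕ}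
    {c c' : TM2.Cfg Γ Λ σ} (h : ReachesWithin (TM2.step M) n c c') :
    ReachesWithin (TM2.step N) n (liftCfg next w D c) (liftCfg next w D c') := by
  obtain ⟨k, hk, e⟩ := h
  refine ReachesWithin.mono ?_ hk
  clear hk
  induction k generalizing c with
  | zero =>
    obtain rfl : c = c' := by simpa using e
    exact .refl ..
  | succ k ih =>
    rw [Function.iterate_succ_apply] at e
    rcases c with ⟨_ | l, v, S⟩
    -- A halted configuration has no successor, so nothing beyond `next` has to be matched.
    · have : (flip bind (TM2.step M))^[k] none = none := Function.iterate_fixed rfl k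
      exact absurd (this.symm.trans e) (by simp)
    · refine .head ?_ (ih e)
      change some (TM2.stepAux (N (.inl l)) _ _) = _
      rw [hN, stepAux_liftStmt]

end Subroutine

/-! ### Approximating a weight that is given by a predicate -/

/-- The stacks that are added to those of a machine for a predicate. -/
inductive SignStack
  | input | middle | fuel | out
  deriving DecidableEq

instance : Fintype SignStack := ⟨{.input, .middle, .fuel, .out}, fun k => by cases k <;> decide⟩

/-- The alphabets of the additional stacks. -/
def SignStack.symbol : SignStack → Type
  | input => TripleSymbol
  | middle => Bool ⊕ Bool
  | fuel => Bool
  | out => Bool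

/-- The labels that are added to those of a machine for a predicate. -/
inductive SignLabel
  | split | move | fill | sign
  deriving DecidableEq

instance : Fintype SignLabel := ⟨{.split, .move, .fill, .sign}, fun l => by cases l <;> decide⟩

/-- The contents of the additional stacks. -/
def signStore (i : List TripleSymbol) (m : List (Bool ⊕ Bool)) (f o : List Bool) :
    ∀ e : SignStack, List e.symbol
  | .input => i
  | .middle => m
  | .fuel => f
  | .out => o

section

variable (i i' : List TripleSymbol) (m m' : List (Bool ⊕ Bool)) (f o l : List Bool)

variable {K : Type} [DecidableEq K] {Γ : K → Type} (S : ∀ k, List (Γ k))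

theorem update_joinStacks_input : Function.update (joinStacks S (signStore i m f o))
    (.inr .input) i' = joinStacks S (signStore i' m f o) := by
  refine (update_joinStacks_inr S _ _ _).trans (congrArg _ (funext fun k => ?_))
  cases k <;> rfl

theorem update_joinStacks_middle : Function.update (joinStacks S (signStore i m f o))
    (.inr .middle) m' = joinStacks S (signStore i m' f o) := by
  refine (update_joinStacks_inr S _ _ _).trans (congrArg _ (funext fun k => ?_))
  cases k <;> rfl

theorem update_joinStacks_fuel : Function.update (joinStacks S (signStore i m f o))
    (.inr .fuel) l = joinStacks S (signStore i m l o) := by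
  refine (update_joinStacks_inr S _ _ _).trans (congrArg _ (funext fun k => ?_))
  cases k <;> rfl

theorem update_joinStacks_out : Function.update (joinStacks S (signStore i m f o))
    (.inr .out) l = joinStacks S (signStore i m f l) := by
  refine (update_joinStacks_inr S _ _ _).trans (congrArg _ (funext fun k => ?_))
  cases k <;> rfl

end

section Sign

variable (A : TM2ComputableAux (Bool ⊕ Bool) Bool)

/-- The statements of the machine that computes a sign from a predicate. -/
abbrev SignStmt : Type :=
  TM2.Stmt (Sum.elim A.tm.Γ SignStack.symbol) (A.tm.Λ ⊕ SignLabel) (A.tm.σ × Option TripleSymbol)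

/-- The program that moves the input to the input stack of a machine for a predicate, runs this
machine, and then writes the number `±2 ^ b`, the sign of which is given by the predicate. -/
def signProgram : A.tm.Λ ⊕ SignLabel → SignStmt A
  | .inl l => liftStmt SignStack.symbol (Option TripleSymbol) .fill (A.tm.m l)
  | .inr .split =>
    .pop (.inr .input) (fun v (o : Option TripleSymbol) => (v.1, o)) <|
      .branch (fun v => v.2.isNone) (.goto fun _ => .inr .move) <|
        .branch (fun v => v.2.any Sum.isLeft)
          (.push (.inr .middle)
            (fun v => show Bool ⊕ Bool from (v.2.bind Sum.getLeft?).getD (.inl false))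
            (.goto fun _ => .inr .split))
          (.push (.inr .fuel) (fun _ => true) (.goto fun _ => .inr .split))
  | .inr .move =>
    .pop (.inr .middle) (fun v (o : Option (Bool ⊕ Bool)) => (v.1, o.map Sum.inl)) <|
      .branch (fun v => v.2.isNone)
        (.push (.inr .out) (fun _ => true) (.goto fun _ => .inl A.tm.main)) <|
        .push (.inl A.tm.k₀)
          (fun v => A.inputAlphabet.symm ((v.2.bind Sum.getLeft?).getD (.inl false)))
          (.goto fun _ => .inr .move)
  | .inr .fill =>
    .pop (.inr .fuel) (fun v (o : Option Bool) => (v.1, o.map Sum.inr)) <|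
      .branch (fun v => v.2.isNone) (.goto fun _ => .inr .sign) <|
        .push (.inr .out) (fun _ => false) (.goto fun _ => .inr .fill)
  | .inr .sign =>
    .pop (.inl A.tm.k₁) (fun v o => (v.1, o.map fun a => .inr (A.outputAlphabet a))) <|
      .push (.inr .out) (fun v => !(v.2.any fun s => s == .inr true)) <|
        .load (fun v => (v.1, none)) .halt

/-- The machine that computes a sign from a predicate. -/
def signMachine : FinTM2 where
  K := A.tm.K ⊕ SignStack
  kDecidableEq := instDecidableEqSum
  kFin := @instFintypeSum _ _ A.tm.kFin _
  k₀ := .inr .input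
  k₁ := .inr .out
  Γ := Sum.elim A.tm.Γ SignStack.symbol
  Λ := A.tm.Λ ⊕ SignLabel
  main := .inr .split
  ΛFin := @instFintypeSum _ _ A.tm.ΛFin _
  σ := A.tm.σ × Option TripleSymbol
  initialState := (A.tm.initialState, none)
  σFin := @instFintypeProd _ _ A.tm.σFin _
  Γk₀Fin := inferInstanceAs (Fintype TripleSymbol)
  m := signProgram A

/-- The steps of the machine that computes a sign. -/
abbrev signStep := TM2.step (signProgram A)

variable {A}

/-- The configurations of the machine that computes a sign, outside of the subroutine. -/
def signCfg (l : Option (A.tm.Λ ⊕ SignLabel)) (w : Option TripleSymbol) (S : ∀ k, List (A.tm.Γ k))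
    (D : ∀ e : SignStack, List e.symbol) :
    TM2.Cfg (Sum.elim A.tm.Γ SignStack.symbol) (A.tm.Λ ⊕ SignLabel)
      (A.tm.σ × Option TripleSymbol) :=
  ⟨l, (A.tm.initialState, w), joinStacks S D⟩

section

variable (S : ∀ k, List (A.tm.Γ k)) (w : Option TripleSymbol) (i : List TripleSymbol)
  (m : List (Bool ⊕ Bool)) (f o : List Bool)

/-- Exchanges equal stacks without rewriting in dependent types; the steps themselves then hold by
unfolding. -/
theorem some_stepAux_congr (q : SignStmt A) (v : A.tm.σ × Option TripleSymbol)
    {J J' : ∀ k, List (Sum.elim A.tm.Γ SignStack.symbol k)} (h : J = J') :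
    some (TM2.stepAux q v J) = some (TM2.stepAux q v J') := h ▸ rfl

theorem step_split_nil : signStep A (signCfg (some (.inr .split)) w S (signStore [] m f o)) =
    some (signCfg (some (.inr .move)) none S (signStore [] m f o)) :=
  some_stepAux_congr (.goto fun _ => .inr .move) (A.tm.initialState, none)
    (update_joinStacks_input ..)

theorem step_split_inl (s : Bool ⊕ Bool) :
    signStep A (signCfg (some (.inr .split)) w S (signStore (.inl s :: i) m f o)) =
      some (signCfg (some (.inr .split)) (some (.inl s)) S (signStore i (s :: m) f o)) := by
  refine (some_stepAux_congr (.push (.inr .middle)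
    (fun v => show Bool ⊕ Bool from (v.2.bind Sum.getLeft?).getD (.inl false))
    (.goto fun _ => .inr .split)) (A.tm.initialState, some (.inl s))
    (update_joinStacks_input (i' := i) ..)).trans ?_
  exact some_stepAux_congr (.goto fun _ => .inr .split)
    (A.tm.initialState, some (.inl s)) (update_joinStacks_middle ..)

theorem step_split_inr (b : Bool) :
    signStep A (signCfg (some (.inr .split)) w S (signStore (.inr b :: i) m f o)) =
      some (signCfg (some (.inr .split)) (some (.inr b)) S (signStore i m (true :: f) o)) := by
  refine (some_stepAux_congr (.push (.inr .fuel) (fun _ => true)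
    (.goto fun _ => .inr .split)) (A.tm.initialState, some (.inr b))
    (update_joinStacks_input (i' := i) ..)).trans ?_
  exact some_stepAux_congr (.goto fun _ => .inr .split)
    (A.tm.initialState, some (.inr b)) (update_joinStacks_fuel ..)

theorem step_move_nil : signStep A (signCfg (some (.inr .move)) w S (signStore i [] f o)) =
    some (signCfg (some (.inl A.tm.main)) none S (signStore i [] f (true :: o))) := by
  refine (some_stepAux_congr (.push (.inr .out) (fun _ => true)
    (.goto fun _ => .inl A.tm.main)) (A.tm.initialState, none)
    (update_joinStacks_middle (m' := []) ..)).trans ?_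
  exact some_stepAux_congr (.goto fun _ => .inl A.tm.main)
    (A.tm.initialState, none) (update_joinStacks_out ..)

theorem step_move_cons (s : Bool ⊕ Bool) :
    signStep A (signCfg (some (.inr .move)) w S (signStore i (s :: m) f o)) =
      some (signCfg (some (.inr .move)) (some (.inl s))
        (Function.update S A.tm.k₀ (A.inputAlphabet.symm s :: S A.tm.k₀))
        (signStore i m f o)) := by
  refine (some_stepAux_congr (.push (.inl A.tm.k₀)
    (fun v => A.inputAlphabet.symm ((v.2.bind Sum.getLeft?).getD (.inl false)))
    (.goto fun _ => .inr .move)) (A.tm.initialState, some (.inl s))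
    (update_joinStacks_middle (m' := m) ..)).trans ?_
  exact some_stepAux_congr (.goto fun _ => .inr .move)
    (A.tm.initialState, some (.inl s)) (update_joinStacks_inl ..)

theorem step_fill_nil : signStep A (signCfg (some (.inr .fill)) w S (signStore i m [] o)) =
    some (signCfg (some (.inr .sign)) none S (signStore i m [] o)) :=
  some_stepAux_congr (.goto fun _ => .inr .sign) (A.tm.initialState, none)
    (update_joinStacks_fuel ..)

theorem step_fill_cons (b : Bool) :
    signStep A (signCfg (some (.inr .fill)) w S (signStore i m (b :: f) o)) =
      some (signCfg (some (.inr .fill)) (some (.inr b)) S (signStore i m f (false :: o))) := by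
  refine (some_stepAux_congr (.push (.inr .out) (fun _ => false)
    (.goto fun _ => .inr .fill)) (A.tm.initialState, some (.inr b))
    (update_joinStacks_fuel (l := f) ..)).trans ?_
  exact some_stepAux_congr (.goto fun _ => .inr .fill)
    (A.tm.initialState, some (.inr b)) (update_joinStacks_out ..)

theorem step_sign (a : A.tm.Γ A.tm.k₁) (l : List (A.tm.Γ A.tm.k₁)) (hS : S A.tm.k₁ = a :: l) :
    signStep A (signCfg (some (.inr .sign)) w S (signStore i m f o)) =
      some (signCfg none none (Function.update S A.tm.k₁ l)
        (signStore i m f ((!A.outputAlphabet a) :: o))) := by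
  have h1 : signStep A (signCfg (some (.inr .sign)) w S (signStore i m f o)) =
      some (TM2.stepAux (.push (.inr .out) (fun v => !(v.2.any fun s => s == .inr true)) <|
        .load (fun v => (v.1, none)) .halt : SignStmt A)
        (A.tm.initialState, (S A.tm.k₁).head?.map fun a => .inr (A.outputAlphabet a))
        (Function.update (joinStacks S (signStore i m f o)) (.inl A.tm.k₁) (S A.tm.k₁).tail)) := rfl
  rw [h1, hS]
  refine (some_stepAux_congr _ _ (update_joinStacks_inl ..)).trans ?_
  refine (some_stepAux_congr (.load (fun v => (v.1, none)) .halt) _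
    (update_joinStacks_out ..)).trans ?_
  have h2 (c : Bool) : (Sum.inr c == (.inr true : TripleSymbol)) = c := by cases c <;> rfl
  rw [← h2 (A.outputAlphabet a)]
  rfl

end

/-- The pair lands on `middle` in reverse; the second transfer, in `reaches_main`, restores its
order. -/
theorem reaches_move (S : ∀ k, List (A.tm.Γ k)) (w : Option TripleSymbol) (z m : List (Bool ⊕ Bool))
    (l f o : List Bool) :
    ReachesWithin (signStep A) (z.length + l.length + 1)
      (signCfg (some (.inr .split)) w S (signStore (z.map Sum.inl ++ l.map Sum.inr) m f o))
      (signCfg (some (.inr .move)) none S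
        (signStore [] (z.reverse ++ m) (List.replicate l.length true ++ f) o)) := by
  induction z generalizing m w with
  | nil =>
    induction l generalizing f w with
    | nil => exact .single (step_split_nil ..)
    | cons b l ih =>
      refine .congr_right (.head (step_split_inr ..) (ih _ _)) ?_
      rw [replicate_append_cons]
      rfl
  | cons s z ih =>
    refine .congr_right (.mono (.head (step_split_inl ..) (ih _ _)) ?_) ?_
    · simp only [List.length_cons]; omega
    · simp

theorem reaches_main (w : Option TripleSymbol) (m : List (Bool ⊕ Bool))
    (l : List (A.tm.Γ A.tm.k₀)) (i : List TripleSymbol) (f o : List Bool) :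
    ReachesWithin (signStep A) (m.length + 1)
      (signCfg (some (.inr .move)) w (initList A.tm l).stk (signStore i m f o))
      (signCfg (some (.inl A.tm.main)) none
        (initList A.tm (m.reverse.map A.inputAlphabet.symm ++ l)).stk
        (signStore i [] f (true :: o))) := by
  induction m generalizing l w with
  | nil => exact .single (step_move_nil ..)
  | cons s m ih =>
    have : Function.update (initList A.tm l).stk A.tm.k₀
        (A.inputAlphabet.symm s :: (initList A.tm l).stk A.tm.k₀) =
        (initList A.tm (A.inputAlphabet.symm s :: l)).stk := by
      funext k
      by_cases h : k = A.tm.k₀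
      · subst h
        simp [initList]
      · simp [initList, h]
    refine .congr_right (.head ((step_move_cons ..).trans (by rw [this])) (ih _ _)) ?_
    simp

theorem reaches_sign (S : ∀ k, List (A.tm.Γ k)) (w : Option TripleSymbol)
    (m : List (Bool ⊕ Bool)) (i : List TripleSymbol) (f o : List Bool) :
    ReachesWithin (signStep A) (f.length + 1)
      (signCfg (some (.inr .fill)) w S (signStore i m f o))
      (signCfg (some (.inr .sign)) none S
        (signStore i m [] (List.replicate f.length false ++ o))) := by
  induction f generalizing o w with
  | nil => exact .single (step_fill_nil ..)
  | cons b f ih =>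
    refine .congr_right (.head (step_fill_cons ..) (ih _ _)) ?_
    rw [replicate_append_cons]
    rfl

/-- The sign that is computed from a predicate, times `2 ^ b`. -/
theorem polyTimeApproximator_sign {T : List Bool → List Bool → Bool} (hT : PolyTimePredicate T) :
    PolyTimeApproximator fun x u b => (if !T x u then -1 else 1) * 2 ^ b := by
  obtain ⟨h⟩ := hT
  set A := h.toTM2ComputableAux with hA
  refine ⟨⟨⟨signMachine A, Equiv.refl _, Equiv.refl _⟩, h.time + 3 * .X + 10, fun z => ?_⟩⟩
  obtain ⟨⟨x, u⟩, b⟩ := z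
  refine Classical.choice ?_
  set z := encodingPair.encode (x, u) with hz
  have hin : encodingTriple.encode ((x, u), b) =
      z.map Sum.inl ++ (List.replicate b true).map Sum.inr := by
    rw [hz, encodingTriple, Computability.encodingProd]
    simp [Computability.unaryEncodingNat, unaryEncodeNat_eq_replicate]
  obtain ⟨⟨⟨n, hn⟩, hle⟩⟩ : Nonempty _ := ⟨h.outputsFun (x, u)⟩
  have hrun : ReachesWithin (TM2.step A.tm.m) (h.time.eval z.length)
      (initList A.tm (z.map A.inputAlphabet.symm))
      (haltList A.tm [A.outputAlphabet.symm (T x u)]) := ⟨n, hle, hn⟩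
  have h1 := reaches_move (A := A) (fun _ => []) none z [] (List.replicate b true) [] []
  have h2 := reaches_main (A := A) none z.reverse [] [] (List.replicate b true) []
  have h3 := reachesWithin_liftCfg (N := signProgram A) (next := SignLabel.fill) (fun _ => rfl) none
    (signStore [] [] (List.replicate b true) [true]) hrun
  have h4 := reaches_sign (A := A) (haltList A.tm [A.outputAlphabet.symm (T x u)]).stk none [] []
    (List.replicate b true) [true]
  have h5 := step_sign (A := A) (haltList A.tm [A.outputAlphabet.symm (T x u)]).stk none [] [] []
    (List.replicate b false ++ [true]) (A.outputAlphabet.symm (T x u)) [] (by simp [haltList])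
  have hstart : signCfg (some (.inr .split)) none (fun _ => [])
      (signStore (encodingTriple.encode ((x, u), b)) [] [] []) =
      initList (signMachine A) (encodingTriple.encode ((x, u), b)) := by
    unfold initList signCfg
    congr 1
    funext k
    rcases k with k | k
    · rfl
    · cases k <;> rfl
  have hhalt (l : List Bool) : signCfg none none (fun _ => []) (signStore [] [] [] l) =
      haltList (signMachine A) l := by
    unfold haltList signCfg
    congr 1
    funext k
    rcases k with k | k
    · rfl
    · cases k <;> rfl
  have hempty : (initList A.tm []).stk = fun _ => [] := by
    funext k
    by_cases h : k = A.tm.k₀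
    · subst h
      simp [initList]
    · simp [initList, h]
  have hempty' : Function.update (haltList A.tm [A.outputAlphabet.symm (T x u)]).stk A.tm.k₁ [] =
      fun _ => [] := by
    funext k
    by_cases h : k = A.tm.k₁
    · subst h
      simp
    · simp [haltList, h]
  rw [← hin] at h1
  simp only [List.length_replicate, List.append_nil] at h1 h4
  rw [hempty] at h2
  simp only [List.reverse_reverse, List.append_nil, List.length_reverse] at h2
  rw [hempty', Equiv.apply_symm_apply, hhalt] at h5
  rw [hstart] at h1
  have hall := h1.trans (h2.trans (h3.trans (h4.trans (.single h5))))
  have hlen : (encodingTriple.encode ((x, u), b)).length = z.length + b := by simp [hin]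
  have htime : z.length + b + 1 + (z.length + 1 + (h.time.eval z.length + (b + 1 + 1))) ≤
      (h.time + 3 * .X + 10).eval (z.length + b) := by
    -- Polynomials with natural coefficients are monotone, so the time on the pair is bounded by the
    -- value at the length of the triple.
    have : h.time.eval z.length ≤ h.time.eval (z.length + b) := by
      simp only [Polynomial.eval_eq_sum_range]
      gcongr
      exact Nat.le_add_right ..
    simp
    omega
  have := (hall.mono htime).nonempty_evalsToInTime
  unfold TM2OutputsInTime
  simp only [Equiv.invFun_as_coe, Equiv.refl_symm, Equiv.coe_refl, Option.map_some]
  rw [encodingInt_two_pow, hlen]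
  erw [List.map_id, List.map_id]
  exact this

end Sign

theorem approximable_sign {T : List Bool → List Bool → Bool} (hT : PolyTimePredicate T) :
    Approximable fun x u => if !T x u then -1 else 1 := by
  refine ⟨_, polyTimeApproximator_sign hT, fun x u b => ?_⟩
  have h : (2 : ℝ) ^ b ≠ 0 := by positivity
  rcases hx : T x u <;> simp [h, hx]

theorem weightedSum_sign (T : List Bool → List Bool → Bool) (p : Polynomial ℕ) (x : List Bool) :
    weightedSum p (fun x u => if !T x u then -1 else 1) x =
      2 * (Finset.univ.filter fun u : Fin (p.eval x.length) → Bool =>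
        T x (List.ofFn u) = true).card - 2 ^ p.eval x.length := by
  have h (u : Fin (p.eval x.length) → Bool) : (if !T x (List.ofFn u) then -1 else 1 : ℝ) =
      2 * (if T x (List.ofFn u) = true then 1 else 0) - 1 := by
    cases T x (List.ofFn u) <;> norm_num
  simp only [weightedSum, h, Finset.sum_sub_distrib, ← Finset.mul_sum, Finset.sum_boole]
  simp

/-- With `n` accepting paths the sum is the integer `2n - 2^p`, so the strict majority condition
becomes the weak inequality with threshold `1`. -/
theorem pp_subset_ppOver_rationals : PP ⊆ PPOver rationals := by
  rintro L ⟨p, T, hT, hL⟩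
  refine ⟨_, ⟨p, fun x u => if !T x u then -1 else 1, approximable_sign hT, fun x u => ?_, rfl⟩, 1,
    Set.ext fun x => ?_⟩
  · exact ⟨if !T x u then -1 else 1, by rcases h : T x u <;> simp [h]⟩
  · rw [Set.mem_ofPred_eq, weightedSum_sign]
    set n := (Finset.univ.filter fun u : Fin (p.eval x.length) → Bool =>
      T x (List.ofFn u) = true).card with hn
    have hpos : (0 : ℚ) < 2 ^ p.eval x.length := by positivity
    constructor
    · intro hx
      have h := (hL x).1 hx
      rw [← hn, lt_div_iff₀ hpos] at h
      have h' : 2 ^ p.eval x.length + 1 ≤ 2 * n := by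
        have : (2 ^ p.eval x.length : ℚ) < 2 * n := by linarith
        exact_mod_cast this
      have : ((2 ^ p.eval x.length + 1 : ℕ) : ℝ) ≤ ((2 * n : ℕ) : ℝ) := Nat.cast_le.2 h'
      push_cast at this ⊢
      linarith
    · intro h
      by_contra hx
      have h1 := (hL x).2 hx
      rw [← hn, div_le_iff₀ hpos] at h1
      have h' : 2 * n ≤ 2 ^ p.eval x.length := by
        have : (2 * n : ℚ) ≤ 2 ^ p.eval x.length := by linarith
        exact_mod_cast this
      have : ((2 * n : ℕ) : ℝ) ≤ ((2 ^ p.eval x.length : ℕ) : ℝ) := Nat.cast_le.2 h'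
      push_cast at this h
      linarith

/-! ### Primitive recursive simulation of machines with stacks -/

/-- The symbols that a statement can push. -/
def pushedSymbols {K : Type} {Γ : K → Type} {Λ σ : Type} : TM2.Stmt Γ Λ σ → Set (Σ k, Γ k)
  | .push k f q => Set.range (fun v => ⟨k, f v⟩) ∪ pushedSymbols q
  | .peek _ _ q => pushedSymbols q
  | .pop _ _ q => pushedSymbols q
  | .load _ q => pushedSymbols q
  | .branch _ q₁ q₂ => pushedSymbols q₁ ∪ pushedSymbols q₂
  | .goto _ => ∅
  | .halt => ∅

/-- `FinTM2` asks for a finite alphabet on the input stack only. A symbol that is not part of the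
input must have been pushed, and finitely many states push finitely many symbols. -/
theorem finite_pushedSymbols {K : Type} {Γ : K → Type} {Λ σ : Type} [Finite σ]
    (q : TM2.Stmt Γ Λ σ) : (pushedSymbols q).Finite := by
  induction q with
  | push k f q ih => exact (Set.finite_range _).union ih
  | branch p q₁ q₂ ih₁ ih₂ => exact ih₁.union ih₂
  | goto => exact Set.finite_empty
  | halt => exact Set.finite_empty
  | _ => assumption

theorem primrec_of_finite_left {α β γ : Type} [Primcodable α] [Finite α] [Primcodable β]
    [Primcodable γ] {f : α → β → γ} (hf : ∀ a, Primrec (f a)) : Primrec₂ f := by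
  obtain ⟨n, ⟨e⟩⟩ := Finite.exists_equiv_fin α
  have h : Primrec₂ fun i b => f (e.symm i) b := Primrec.fin_curry₁.2 fun i => hf (e.symm i)
  exact (h.comp ((Primrec.dom_finite e).comp .fst) .snd).of_eq fun z => by simp

theorem primrec_update {α β : Type} [Primcodable α] [Primcodable β] {n : ℕ} (i : Fin n)
    {f : α → Fin n → β} {g : α → β} (hf : Primrec f) (hg : Primrec g) :
    Primrec fun a => Function.update (f a) i (g a) := by
  refine Primrec.fin_curry.2 ?_
  refine (Primrec.ite (Primrec.eq.comp .snd (.const i)) (hg.comp .fst)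
    ((Primrec.fin_curry.1 hf).comp .fst .snd)).of_eq fun z => ?_
  simp [Function.update_apply]

section Simulation

variable {K : Type} {Γ : K → Type} {Λ σ N : Type} {n : ℕ} (e : K ≃ Fin n) (val : N → Σ k, Γ k)

/-- The stacks `C` of codes of symbols represent the stacks `S`. -/
def Codes (S : ∀ k, List (Γ k)) (C : Fin n → List N) : Prop :=
  ∀ k, (S k).map (Sigma.mk k) = (C (e k)).map val

open Classical in
/-- The symbol of the stack `k` with a given code. -/
noncomputable def decodeSymbol (k : K) (c : N) : Option (Γ k) :=
  if h : (val c).1 = k then some (h ▸ (val c).2) else none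

variable {e val} {S : ∀ k, List (Γ k)} {C : Fin n → List N}

theorem decodeSymbol_eq {k : K} {a : Γ k} {c : N} (h : val c = ⟨k, a⟩) :
    decodeSymbol val k c = some a := by
  have h' : (val c).1 = k := by rw [h]
  rw [decodeSymbol, dif_pos h']
  congr 1
  apply eq_of_heq
  refine (eqRec_heq ..).trans ?_
  rw [h]

theorem Codes.head? (h : Codes e val S C) (k : K) :
    (C (e k)).head?.bind (decodeSymbol val k) = (S k).head? := by
  have h := h k
  rcases hS : S k with _ | ⟨a, l⟩ <;> rcases hC : C (e k) with _ | ⟨c, l'⟩ <;>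
    simp only [hS, hC, List.map_nil, List.map_cons, List.cons.injEq, reduceCtorEq] at h
  · rfl
  · exact decodeSymbol_eq h.1.symm

variable [DecidableEq K]

theorem Codes.update (h : Codes e val S C) {k : K} {l : List (Γ k)} {l' : List N}
    (hl : l.map (Sigma.mk k) = l'.map val) :
    Codes e val (Function.update S k l) (Function.update C (e k) l') := by
  intro k'
  by_cases hk : k' = k
  · subst hk
    simpa using hl
  · simpa [hk] using h k'

/-- A code of a configuration. -/
def CodesCfg (e : K ≃ Fin n) (val : N → Σ k, Γ k) (c : TM2.Cfg Γ Λ σ)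
    (d : (Option Λ × σ) × (Fin n → List N)) : Prop :=
  d.1 = (c.l, c.var) ∧ Codes e val c.stk d.2

/-- Because of `getD c`, a halted configuration stays put. So `F` may be iterated up to the time
bound `m` even if the machine halts earlier. -/
theorem iterate_codesCfg {M : Λ → TM2.Stmt Γ Λ σ}
    {F : (Option Λ × σ) × (Fin n → List N) → (Option Λ × σ) × (Fin n → List N)}
    (hF : ∀ c d, CodesCfg e val c d → CodesCfg e val ((TM2.step M c).getD c) (F d))
    {m : ℕ} {c c' : TM2.Cfg Γ Λ σ} (h : ReachesWithin (TM2.step M) m c c') (hc' : c'.l = none)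
    {d : (Option Λ × σ) × (Fin n → List N)} (hd : CodesCfg e val c d) :
    CodesCfg e val c' (F^[m] d) := by
  obtain ⟨k, hk, hkc⟩ := h
  induction m generalizing k c d with
  | zero =>
    obtain rfl : k = 0 := by omega
    obtain rfl : c = c' := by simpa using hkc
    exact hd
  | succ m ih =>
    rw [Function.iterate_succ_apply]
    rcases c with ⟨_ | l, v, S⟩
    · rcases k with _ | k
      · exact ih (hF _ _ hd) 0 (by omega) hkc
      · rw [Function.iterate_succ_apply] at hkc
        have : (flip bind (TM2.step M))^[k] none = none := Function.iterate_fixed rfl k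
        exact absurd (this.symm.trans hkc) (by simp)
    · rcases k with _ | k
      · obtain rfl : _ = c' := by simpa using hkc
        simp at hc'
      · rw [Function.iterate_succ_apply] at hkc
        exact ih (hF _ _ hd) k (by omega) hkc

variable [Primcodable Λ] [Primcodable σ] [Primcodable N] [Finite σ] [Finite N]

variable (e) in
-- The functions inside a statement have finite domains once symbols are coded in `N`, so they are
-- primitive recursive; the stacks are touched only by `cons`, `head?` and `tail`.
theorem exists_primrec_stepAux (q : TM2.Stmt Γ Λ σ) (hq : ∀ z ∈ pushedSymbols q, ∃ c, val c = z) :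
    ∃ F : σ × (Fin n → List N) → (Option Λ × σ) × (Fin n → List N), Primrec F ∧
      ∀ v S C, Codes e val S C → (F (v, C)).1 = ((TM2.stepAux q v S).l, (TM2.stepAux q v S).var) ∧
        Codes e val (TM2.stepAux q v S).stk (F (v, C)).2 := by
  have happ (k : K) : Primrec fun p : σ × (Fin n → List N) => p.2 (e k) :=
    Primrec.fin_app.comp .snd (.const _)
  have hpeek (k : K) (f : σ → Option (Γ k) → σ) : Primrec fun p : σ × (Fin n → List N) =>
      f p.1 ((p.2 (e k)).head?.bind (decodeSymbol val k)) :=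
    (Primrec.dom_finite fun z : σ × Option N => f z.1 (z.2.bind (decodeSymbol val k))).comp
      (Primrec.fst.pair (Primrec.list_head?.comp (happ k)))
  induction q with
  | push k f q ih =>
    obtain ⟨F, hF, h⟩ := ih fun z hz => hq z (.inr hz)
    choose g hg using fun v => hq ⟨k, f v⟩ (.inl ⟨v, rfl⟩)
    refine ⟨fun p => F (p.1, Function.update p.2 (e k) (g p.1 :: p.2 (e k))), hF.comp
      (Primrec.fst.pair (primrec_update _ .snd
        (Primrec.list_cons.comp ((Primrec.dom_finite g).comp .fst) (happ k)))),
      fun v S C hC => h _ _ _ (hC.update ?_)⟩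
    simp [hg, hC k]
  | peek k f q ih =>
    obtain ⟨F, hF, h⟩ := ih hq
    refine ⟨fun p => F (f p.1 ((p.2 (e k)).head?.bind (decodeSymbol val k)), p.2),
      hF.comp ((hpeek k f).pair .snd), fun v S C hC => ?_⟩
    simp only [hC.head? k]
    exact h _ _ _ hC
  | pop k f q ih =>
    obtain ⟨F, hF, h⟩ := ih hq
    refine ⟨fun p => F (f p.1 ((p.2 (e k)).head?.bind (decodeSymbol val k)),
      Function.update p.2 (e k) (p.2 (e k)).tail),
      hF.comp ((hpeek k f).pair (primrec_update _ .snd (Primrec.list_tail.comp (happ k)))),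
      fun v S C hC => ?_⟩
    simp only [hC.head? k]
    exact h _ _ _ (hC.update (by simp [List.map_tail, hC k]))
  | load f q ih =>
    obtain ⟨F, hF, h⟩ := ih hq
    exact ⟨fun p => F (f p.1, p.2), hF.comp (((Primrec.dom_finite f).comp .fst).pair .snd),
      fun v S C hC => h _ _ _ hC⟩
  | branch p q₁ q₂ ih₁ ih₂ =>
    obtain ⟨F₁, hF₁, h₁⟩ := ih₁ fun z hz => hq z (.inl hz)
    obtain ⟨F₂, hF₂, h₂⟩ := ih₂ fun z hz => hq z (.inr hz)
    refine ⟨fun z => bif p z.1 then F₁ z else F₂ z,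
      Primrec.cond ((Primrec.dom_finite p).comp .fst) hF₁ hF₂, fun v S C hC => ?_⟩
    simp only [TM2.stepAux]
    cases p v
    · exact h₂ _ _ _ hC
    · exact h₁ _ _ _ hC
  | goto l =>
    exact ⟨fun p => ((some (l p.1), p.1), p.2),
      ((Primrec.dom_finite fun v => (some (l v), v)).comp .fst).pair .snd,
      fun v S C hC => ⟨rfl, hC⟩⟩
  | halt =>
    exact ⟨fun p => ((none, p.1), p.2), (((Primrec.const none).pair .id).comp .fst).pair .snd,
      fun v S C hC => ⟨rfl, hC⟩⟩

variable (e) in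
theorem exists_primrec_step [Finite Λ] (M : Λ → TM2.Stmt Γ Λ σ)
    (hM : ∀ l, ∀ z ∈ pushedSymbols (M l), ∃ c, val c = z) :
    ∃ F : (Option Λ × σ) × (Fin n → List N) → (Option Λ × σ) × (Fin n → List N), Primrec F ∧
      ∀ c d, CodesCfg e val c d → CodesCfg e val ((TM2.step M c).getD c) (F d) := by
  choose F hF h using fun l => exists_primrec_stepAux e (M l) (hM l)
  refine ⟨fun d => (d.1.1.map fun l => F l (d.1.2, d.2)).getD d, ?_, ?_⟩
  · refine Primrec.option_getD.comp (Primrec.option_map (Primrec.fst.comp .fst) ?_) .id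
    exact (primrec_of_finite_left hF).comp .snd
      ((Primrec.snd.comp (.comp .fst .fst)).pair (Primrec.snd.comp .fst))
  · rintro ⟨l, v, S⟩ ⟨_, C⟩ ⟨rfl, hC⟩
    rcases l with _ | l
    · exact ⟨rfl, hC⟩
    · exact h l v S C hC

end Simulation

/-! ### Decidability of the languages in `PP`, and strictness -/

theorem nonempty_primcodable (α : Type) [Finite α] : Nonempty (Primcodable α) :=
  let ⟨_, ⟨e⟩⟩ := Finite.exists_equiv_fin α
  ⟨.ofEquiv _ e⟩

theorem primrec_polynomial_eval (p : Polynomial ℕ) : Primrec fun n => p.eval n := by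
  induction p using Polynomial.induction_on with
  | C a => simpa using Primrec.const a
  | add p q hp hq => simpa using Primrec.nat_add.comp hp hq
  | monomial n a h =>
    refine (Primrec.nat_mul.comp h .id).of_eq fun m => ?_
    simp [pow_succ, mul_assoc]

theorem primrec_of_polyTimePredicate {T : List Bool → List Bool → Bool}
    (hT : PolyTimePredicate T) : Primrec₂ T := by
  obtain ⟨h⟩ := hT
  -- These finitely many symbols are the only ones that can occur on a stack during a run.
  let R : Set (Σ k, h.tm.Γ k) := (⋃ l, pushedSymbols (h.tm.m l)) ∪ Set.range (Sigma.mk h.tm.k₀)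
  have hΛ : Finite h.tm.Λ := @Finite.of_fintype _ h.tm.ΛFin
  have hσ : Finite h.tm.σ := @Finite.of_fintype _ h.tm.σFin
  have hK : Finite h.tm.K := @Finite.of_fintype _ h.tm.kFin
  have hΓ : Finite (h.tm.Γ h.tm.k₀) := @Finite.of_fintype _ h.tm.Γk₀Fin
  have hR : Finite R :=
    ((Set.finite_iUnion fun l => finite_pushedSymbols _).union (Set.finite_range _)).to_subtype
  obtain ⟨n, ⟨e⟩⟩ := Finite.exists_equiv_fin h.tm.K
  obtain ⟨iΛ⟩ := nonempty_primcodable h.tm.Λ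
  obtain ⟨iσ⟩ := nonempty_primcodable h.tm.σ
  obtain ⟨iR⟩ := nonempty_primcodable R
  obtain ⟨F, hF, hstep⟩ := exists_primrec_step e (val := ((↑) : R → Σ k, h.tm.Γ k)) h.tm.m
    fun l z hz => ⟨⟨z, .inl (Set.mem_iUnion.2 ⟨l, hz⟩)⟩, rfl⟩
  let g (s : Bool ⊕ Bool) : R := ⟨⟨h.tm.k₀, h.inputAlphabet.symm s⟩, .inr ⟨_, rfl⟩⟩
  let start (z : List Bool × List Bool) : (Option h.tm.Λ × h.tm.σ) × (Fin n → List R) :=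
    ((some h.tm.main, h.tm.initialState),
      Function.update (fun _ => []) (e h.tm.k₀) ((encodingPair.encode z).map g))
  have henc : Primrec encodingPair.encode := by
    refine Primrec.list_append.comp (Primrec.list_map .fst ?_) (Primrec.list_map .snd ?_)
    · exact Primrec.sumInl.comp .snd
    · exact Primrec.sumInr.comp .snd
  have hstart : Primrec start :=
    (Primrec.const _).pair (primrec_update _ (.const _)
      (Primrec.list_map henc ((Primrec.dom_finite g).comp .snd).to₂))
  classical
  let ans (o : Option R) : Bool :=
    decide (o.map Subtype.val = some ⟨h.tm.k₁, h.outputAlphabet.symm true⟩)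
  have hfinal : Primrec fun z => F^[h.time.eval (encodingPair.encode z).length] (start z) :=
    Primrec.nat_iterate ((primrec_polynomial_eval _).comp (Primrec.list_length.comp henc)) hstart
      (hF.comp .snd).to₂
  refine ((Primrec.dom_finite ans).comp (Primrec.list_head?.comp (Primrec.fin_app.comp
    (Primrec.snd.comp hfinal) (.const (e h.tm.k₁))))).of_eq fun z => ?_
  obtain ⟨⟨⟨k, hk⟩, hle⟩⟩ : Nonempty _ := ⟨h.outputsFun z⟩
  have hrun : ReachesWithin (TM2.step h.tm.m) (h.time.eval (encodingPair.encode z).length)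
      (initList h.tm ((encodingPair.encode z).map h.inputAlphabet.symm))
      (haltList h.tm [h.outputAlphabet.symm (T z.1 z.2)]) := ⟨k, hle, hk⟩
  have hcode := iterate_codesCfg (e := e) (val := ((↑) : R → Σ k, h.tm.Γ k)) hstep hrun rfl
    (d := start z) ⟨rfl, fun k => ?_⟩
  · have := hcode.2 h.tm.k₁
    have hhead := congrArg List.head? this
    simp only [haltList, dite_true, eq_mpr_eq_cast, cast_eq, List.map_cons, List.map_nil,
      List.head?_cons, List.head?_map] at hhead
    change decide (Option.map _ (List.head? _) = _) = _
    rw [id, ← hhead]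
    rcases T z.1 z.2 <;> simp
  · by_cases hk : k = h.tm.k₀
    · subst hk
      simp [initList, start, g]
    · simp [initList, start, hk]

/-- The list of all bitstrings of a given length. -/
def bitstrings : ℕ → List (List Bool)
  | 0 => [[]]
  | n + 1 => (bitstrings n).map (true :: ·) ++ (bitstrings n).map (false :: ·)

theorem length_bitstrings (n : ℕ) : (bitstrings n).length = 2 ^ n := by
  induction n with
  | zero => rfl
  | succ n ih => simp [bitstrings, ih]; ring

theorem primrec_bitstrings : Primrec bitstrings := by
  have h (b : Bool) : Primrec fun l : List (List Bool) => l.map (b :: ·) :=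
    Primrec.list_map .id (Primrec.list_cons.comp (.const b) .snd).to₂
  refine (Primrec.nat_iterate .id (.const [[]])
    ((Primrec.list_append.comp (h true) (h false)).comp .snd).to₂).of_eq fun n => ?_
  induction n with
  | zero => rfl
  | succ n ih => rw [bitstrings, ← ih]; exact Function.iterate_succ_apply' ..

theorem sum_bitstrings (n : ℕ) (g : List Bool → ℕ) :
    ∑ u : Fin n → Bool, g (List.ofFn u) = ((bitstrings n).map g).sum := by
  induction n generalizing g with
  | zero => simp [bitstrings]
  | succ n ih =>
    rw [← (Fin.consEquiv fun _ => Bool).sum_comp, Fintype.sum_prod_type]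
    simp [Fin.consEquiv, bitstrings, ih fun u => g (true :: u), ih fun u => g (false :: u),
      Function.comp_def]

/-- The accepting strings among all `2^p` are counted one by one, and the majority condition is a
comparison of natural numbers. -/
theorem computablePred_of_mem_pp {L : Set (List Bool)} (hL : L ∈ PP) :
    ComputablePred fun x => x ∈ L := by
  obtain ⟨p, T, hT, hL⟩ := hL
  have hT := primrec_of_polyTimePredicate hT
  let accepting (x : List Bool) : List Unit :=
    (bitstrings (p.eval x.length)).flatMap fun u => bif T x u then [()] else []
  have hall : Primrec fun x : List Bool => bitstrings (p.eval x.length) :=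
    primrec_bitstrings.comp ((primrec_polynomial_eval p).comp .list_length)
  have hacc : Primrec accepting :=
    Primrec.list_flatMap hall (Primrec.cond hT (.const _) (.const _))
  have hlen := Primrec.list_length.comp hacc
  refine ((Primrec.nat_lt.comp (Primrec.list_length.comp hall)
    (Primrec.nat_add.comp hlen hlen)).of_eq fun x => ?_).computablePred
  have hcount : (accepting x).length = (Finset.univ.filter fun u : Fin (p.eval x.length) → Bool =>
      T x (List.ofFn u) = true).card := by
    rw [Finset.card_filter, sum_bitstrings _ fun u => if T x u = true then 1 else 0,
      List.length_flatMap]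
    congr 2
    funext u
    cases T x u <;> rfl
  rw [hcount, length_bitstrings]
  have hpos : (0 : ℚ) < 2 ^ p.eval x.length := by positivity
  have h := hL x
  rw [lt_div_iff₀ hpos, div_le_iff₀ hpos] at h
  set n := (Finset.univ.filter fun u : Fin (p.eval x.length) → Bool =>
      T x (List.ofFn u) = true).card
  constructor
  · intro hn
    by_contra hx
    have hn' : (2 ^ p.eval x.length : ℚ) < n + n := by exact_mod_cast hn
    linarith [h.2 hx]
  · intro hx
    have hn' : (2 ^ p.eval x.length : ℚ) < n + n := by linarith [h.1 hx]
    exact_mod_cast hn'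

theorem pp_ssubset_ppOver_rationals : PP ⊂ PPOver rationals := by
  refine ⟨pp_subset_ppOver_rationals, fun h => not_computablePred_haltingProblem ?_⟩
  have := computablePred_of_mem_pp (h compl_haltingProblem_mem_ppOver)
  exact this.not.of_eq fun x => not_not

/-- Since `h ≥ 0` and denominators are nonzero, `x` is in the halting problem if and only if the
numerator at `x` is nonzero, which is a decidable property of a computed integer. -/
theorem not_exactlyComputable_haltingValue : ¬ExactlyComputable haltingValue := by
  rintro ⟨n, d, hn, -, h⟩
  refine not_computablePred_haltingProblem ?_
  have hpred : ComputablePred fun z : ℤ => z ≠ 0 :=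
    (Primrec.eq.comp .id (.const 0)).not.computablePred
  refine (ComputablePred.computable_of_manyOneReducible ⟨n, hn, fun x => Iff.rfl⟩ hpred).of_eq
    fun x => ?_
  rw [← haltingValue_pos_iff, (haltingValue_nonneg x).lt_iff_ne', (h x).2, ne_eq, ne_eq,
    div_eq_zero_iff]
  simp [(h x).1]

end WeightedCounting

theorem mainTheorem4 :
    -- the weight function is rational and approximable, its weighted sum is the halting value
    (Approximable haltingWeight ∧ (∀ x u, haltingWeight x u ∈ rationals) ∧
      ∀ (p : Polynomial ℕ) (x : List Bool), weightedSum p haltingWeight x = haltingValue x) ∧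
    -- the weighted counting problem belongs to `#P_ℚ`, is not computable, and detects halting
    (haltingValue ∈ SharpPOver rationals ∧ ¬ ExactlyComputable haltingValue ∧
      ∀ (M : Table) (y : List Bool), 0 < haltingValue (pairCode M y) ↔ ∃ t, HaltsIn M y t) ∧
    -- a problem in `PP_ℚ` decides the (undecidable) halting problem
    ((∃ L ∈ PPOver rationals, ∀ x : List Bool, x ∈ haltingProblem ↔ x ∉ L) ∧
      ¬ ComputablePred (fun x : List Bool => x ∈ haltingProblem)) ∧
    -- `PP` is strictly contained in `PP_ℚ`
    PP ⊂ PPOver rationals := by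
  refine ⟨⟨approximable_haltingWeight, haltingWeight_mem_rationals, weightedSum_haltingWeight⟩,
    ⟨haltingValue_mem_sharpPOver, not_exactlyComputable_haltingValue, fun M y => ?_⟩,
    ⟨⟨_, compl_haltingProblem_mem_ppOver, fun x => by simp⟩, not_computablePred_haltingProblem⟩,
    pp_ssubset_ppOver_rationals⟩
  rw [haltingValue_pos_iff]
  constructor
  · rintro ⟨t, N, z, h, ht⟩
    obtain ⟨rfl, rfl⟩ := pairCode_inj h
    exact ⟨t, ht⟩
  · rintro ⟨t, ht⟩
    exact ⟨t, M, y, rfl, ht⟩
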